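/- Let $\beta\ge 0$. Real random variables $(\xi_i)_{i\in I}$ indexed by a finite set $I$ with $|I|=M\ge 1$ are called Curie–Weiss random variables with inverse temperature $\beta$ if they take values in $\{-1,1\}$ and, for every $x\in\{-1,1\}^I$, $$\mathbb P(\xi_i=x_i\text{ for all }i\in I)=Z^{-1}\exp\Big(\frac{\beta}{2M}\Big(\sum_{i\in I}x_i\Big)^2\Big),$$ where $Z=Z_{\beta,M}$ is the normalization constant. On a probability space $(\Omega,\mathcal F,\mathbb P)$ let, for every $N\in\mathbb N$, $(\tilde X_N(i,j))_{1\le i,j\le N}$ be $N^2$ Curie–Weiss random variables with inverse temperature $\beta$ (with an arbitrary joint distribution for different $N$), and let $X_N$ be the real symmetric $N\times N$ matrix with $X_N(i,j)=\tilde X_N(i,j)$ for $i\le j$ and $X_N(i,j)=\tilde X_N(j,i)$ for $i>j$ (the full Curie–Weiss ensemble). Let $\|\cdot\|$ denote the operator norm on the Euclidean space $\mathbb R^N$. Then: (i) If $\beta<1$, then $\mathbb P$-almost surely $\big\|\tfrac{1}{\sqrt N}X_N\big\|\to 2$ as $N\to\infty$. (ii) If $\beta=1$, then $\mathbb P$-almost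 surely, for every $\gamma>1/2$, $\big\|\tfrac{1}{N^{\gamma}}X_N\big\|\to 0$ as $N\to\infty$. (iii) If $\beta>1$, then the equation $\tanh(\beta m)=m$ has a unique strictly positive solution $m=m(\beta)$, and $\mathbb P$-almost surely $\big\|\tfrac1N X_N\big\|\to m(\beta)$ as $N\to\infty$. -/

import Mathlib

open MeasureTheory Filter Topology

noncomputable section

/-- The Boltzmann weight `exp ((β / (2 M)) (∑ i, x i)²)` of a spin configuration
`x ∈ {-1, 1}^ι`, where `M` is the number of elements of `ι`. -/
def curieWeissWeight {ι : Type*} [Fintype ι] (β : ℝ) (x : ι → ℤˣ) : ℝ :=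
  Real.exp (β / (2 * (Fintype.card ι : ℝ)) * (∑ i, ((x i : ℤ) : ℝ)) ^ 2)

/-- The normalization constant `Z`. -/
def curieWeissPartition (ι : Type*) [Fintype ι] [DecidableEq ι] (β : ℝ) : ℝ :=
  ∑ x : ι → ℤˣ, curieWeissWeight β x

/-- The real random variables `ξ i` are Curie-Weiss distributed with inverse temperature `β`:
the configuration `x ∈ {-1, 1}^ι` is attained with probability `Z⁻¹ exp (β / (2 M) (∑ x i)²)`.
(These probabilities add up to `1`, so they determine the joint law.) -/
structure IsCurieWeiss {Ω : Type*} [MeasurableSpace Ω] {ι : Type*} [Fintype ι] [DecidableEq ι]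
    (P : Measure Ω) (β : ℝ) (ξ : ι → Ω → ℝ) : Prop where
  measurable : ∀ i, Measurable (ξ i)
  prob_eq : ∀ x : ι → ℤˣ,
    P {ω | ∀ i, ξ i ω = ((x i : ℤ) : ℝ)} =
      ENNReal.ofReal ((curieWeissPartition ι β)⁻¹ * curieWeissWeight β x)

/-- `X N`, `N ∈ ℕ`, is a full Curie-Weiss ensemble on `(Ω, P)`: the symmetric `N × N` matrix `X N`
has the upper triangular part of an array of `N²` Curie-Weiss variables. Nothing is assumed
about the joint law of the matrices for different `N`. -/
def IsFullCurieWeissEnsemble {Ω : Type*} [MeasurableSpace Ω] (P : Measure Ω) (β : ℝ)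
    (X : (N : ℕ) → Ω → Matrix (Fin N) (Fin N) ℝ) : Prop :=
  ∀ N : ℕ, ∃ Y : Fin N × Fin N → Ω → ℝ, IsCurieWeiss P β Y ∧
    ∀ ω i j, X N ω i j = if i ≤ j then Y (i, j) ω else Y (j, i) ω

/-- The norm of a matrix as an operator on the Euclidean space `ℝ^N`. -/
def euclideanOpNorm {N : ℕ} (A : Matrix (Fin N) (Fin N) ℝ) : ℝ :=
  ‖Matrix.toEuclideanCLM (n := Fin N) (𝕜 := ℝ) A‖

/-- `m` is a strictly positive solution of `tanh (β m) = m`. -/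
def IsCurieWeissMagnetization (β m : ℝ) : Prop :=
  0 < m ∧ Real.tanh (β * m) = m

end

/-!
At `β = 0` the matrix `A` is symmetric with independent random signs as entries. Integration by
parts gives a recursion for the trace moments that is, up to lower order terms, the Catalan
recursion; it bounds `𝔼 tr A ^ (2 k)` by `(1 + O(1 / k)) ^ k * N ^ (k + 1) * catalan k` for
`k ≤ √N`, so `‖A‖ ≥ (2 + ε) √N` has superpolynomially small probability. For fixed `k` this moment
is also asymptotically at least `N ^ (k + 1) * catalan k`, by counting closed walks that retrace
their edges. Hence `‖A‖ ≤ (2 - ε) √N` is superpolynomially unlikely too: by concentration of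
measure on the cube, otherwise most sign patterns would be few flips away from a matrix of small
norm, and their trace moments would be too small.

For `β < 1` the density of the Curie-Weiss law with respect to the uniform law is bounded in some
`L ^ p` with `p > 1`, so these estimates carry over. For `β > 0` the Curie-Weiss law of `M` spins is
a mixture of laws of independent spins with mean `tanh y`, in which `y` has density proportional to
`(cosh y * exp (-y ^ 2 / (2 β))) ^ M`. Given `y`, the matrix is `tanh y` times the all-ones matrix,
of norm `N |tanh y|`, plus a centred part of norm `O(√N)`. For `β > 1` the law of `|y|` concentrates
at the positive solution of `tanh y = y / β`, and for `β = 1` at `0`, on the scale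
`M ^ (-1/4) = N ^ (-1/2)`.

All exceptional probabilities are summable in `N`, so the Borel-Cantelli lemma applies whatever the
joint law of the matrices.
-/

noncomputable section

/-! ### Trace moments of a random sign matrix -/

section RademacherMean

open MvPolynomial
open scoped BigOperators

lemma mvPolynomial_induction_on_pair {σ R : Type*} [CommSemiring R]
    {motive : MvPolynomial σ R → MvPolynomial σ R → Prop}
    (monomial : ∀ d c d' c', motive (monomial d c) (monomial d' c'))
    (add_left : ∀ p p' q, motive p q → motive p' q → motive (p + p') q)
    (add_right : ∀ p q q', motive p q → motive p q' → motive p (q + q'))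
    (p q : MvPolynomial σ R) : motive p q := by
  induction p using MvPolynomial.induction_on' with
  | add p p' hp hp' => exact add_left _ _ _ hp hp'
  | monomial d c =>
    induction q using MvPolynomial.induction_on' with
    | add q q' hq hq' => exact add_right _ _ _ hq hq'
    | monomial d' c' => exact monomial _ _ _ _

lemma even_sub_single_add_sub_single {σ : Type*} {d d' : σ →₀ ℕ} {e : σ}
    (h : ∀ i, Even ((d + d') i)) (hd : Odd (d e)) (hd' : Odd (d' e)) (i : σ) :
    Even ((d - Finsupp.single e 1 + (d' - Finsupp.single e 1) : σ →₀ ℕ) i) := by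
  obtain rfl | hi := eq_or_ne i e
  · simpa only [Finsupp.add_apply, Finsupp.tsub_apply, Finsupp.single_eq_same] using
      (Nat.Odd.sub_odd hd odd_one).add (Nat.Odd.sub_odd hd' odd_one)
  · simpa [Finsupp.single_apply, hi.symm] using h i

/-- A configuration of signs, viewed as a real vector. -/
def signVec {σ : Type*} (x : σ → ℤˣ) : σ → ℝ := fun i => ((x i : ℤ) : ℝ)

variable {σ : Type*} [Fintype σ] [DecidableEq σ]

lemma sum_signs_prod {R : Type*} [CommSemiring R] (f : σ → ℤˣ → R) :
    ∑ x : σ → ℤˣ, ∏ i, f i (x i) = ∏ i, (f i 1 + f i (-1)) := by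
  have h (g : ℤˣ → R) : ∑ s, g s = g 1 + g (-1) := by
    rw [UnitsInt.univ, Finset.sum_pair (by decide)]
  simp_rw [← h, Finset.prod_univ_sum, Fintype.piFinset_univ]

lemma card_signs : Fintype.card (σ → ℤˣ) = 2 ^ Fintype.card σ := by
  rw [Fintype.card_fun, Fintype.card_units_int]

lemma expect_prod_signVec_pow (d : σ → ℕ) :
    𝔼 x : σ → ℤˣ, ∏ i, signVec x i ^ d i = if ∀ i, Even (d i) then 1 else 0 := by
  rw [Fintype.expect_eq_sum_div_card, card_signs, Nat.cast_pow, Nat.cast_ofNat]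
  unfold signVec
  rw [sum_signs_prod fun i s => ((s : ℤ) : ℝ) ^ d i]
  split_ifs with h
  · have hi (i : σ) : (((1 : ℤˣ) : ℤ) : ℝ) ^ d i + (((-1 : ℤˣ) : ℤ) : ℝ) ^ d i = 2 := by
      simp [(h i).neg_one_pow, one_add_one_eq_two]
    simp_rw [hi, Finset.prod_const, Finset.card_univ]
    exact div_self (pow_ne_zero _ two_ne_zero)
  · push Not at h
    obtain ⟨i, hi⟩ := h
    rw [Finset.prod_eq_zero (Finset.mem_univ i), zero_div]
    simp [(Nat.not_even_iff_odd.1 hi).neg_one_pow]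

/-- The expectation of a polynomial with natural coefficients in independent uniform signs.
Natural coefficients make this functional positive. -/
def radMean : MvPolynomial σ ℕ →+ ℝ where
  toFun p := 𝔼 x : σ → ℤˣ, aeval (signVec x) p
  map_zero' := by simp
  map_add' p q := by simp [Finset.expect_add_distrib]

lemma radMean_apply (p : MvPolynomial σ ℕ) :
    radMean p = 𝔼 x : σ → ℤˣ, aeval (signVec x) p := rfl

lemma radMean_monomial (d : σ →₀ ℕ) (c : ℕ) :
    radMean (monomial d c) = c * if ∀ i, Even (d i) then 1 else 0 := by
  rw [radMean_apply, ← expect_prod_signVec_pow, Finset.mul_expect]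
  refine Finset.expect_congr rfl fun x _ => ?_
  rw [aeval_monomial, Finsupp.prod_fintype _ _ fun _ => pow_zero _, eq_natCast]

lemma radMean_nonneg (p : MvPolynomial σ ℕ) : 0 ≤ radMean p := by
  induction p using MvPolynomial.induction_on' with
  | monomial d c => rw [radMean_monomial]; positivity
  | add p q hp hq => rw [map_add]; positivity

lemma radMean_natCast (m : ℕ) : radMean (m : MvPolynomial σ ℕ) = m := by
  simp [radMean_apply]

lemma radMean_mul_radMean_le (p q : MvPolynomial σ ℕ) :
    radMean p * radMean q ≤ radMean (p * q) := by
  induction p, q using mvPolynomial_induction_on_pair with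
  | monomial d c d' c' =>
    rw [monomial_mul, radMean_monomial, radMean_monomial, radMean_monomial, Nat.cast_mul,
      mul_mul_mul_comm]
    gcongr
    split_ifs with h h' h'' <;> simp only [mul_one, mul_zero, le_refl, zero_le_one]
    exact absurd (fun i => (h i).add (h' i)) h''
  | add_left p p' q hp hp' =>
    rw [add_mul, map_add, map_add, add_mul]; exact add_le_add hp hp'
  | add_right p q q' hq hq' =>
    rw [mul_add, map_add, map_add, mul_add]; exact add_le_add hq hq'

lemma radMean_monomial_mul_monomial_le_pderiv {d d' : σ →₀ ℕ} {c c' : ℕ} {e : σ}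
    (h : ∀ i, Even ((d + d') i)) (hd : Odd (d e)) (hd' : Odd (d' e)) :
    radMean (monomial d c * monomial d' c') ≤
      radMean (pderiv e (monomial d c) * pderiv e (monomial d' c')) := by
  rw [pderiv_monomial, pderiv_monomial, monomial_mul, monomial_mul, radMean_monomial,
    radMean_monomial, if_pos h, if_pos (even_sub_single_add_sub_single h hd hd'), mul_one, mul_one]
  exact_mod_cast Nat.mul_le_mul (Nat.le_mul_of_pos_right _ hd.pos)
    (Nat.le_mul_of_pos_right _ hd'.pos)

-- On monomials a nonzero covariance forces some variable `e` to have odd degree in both factors,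
-- and then the `e`-th term of the sum already dominates.
lemma radMean_mul_le (p q : MvPolynomial σ ℕ) :
    radMean (p * q) ≤ radMean p * radMean q + ∑ e, radMean (pderiv e p * pderiv e q) := by
  induction p, q using mvPolynomial_induction_on_pair with
  | monomial d c d' c' =>
    have hterm (e : σ) := radMean_nonneg (pderiv e (monomial d c) * pderiv e (monomial d' c'))
    have hsum := Finset.sum_nonneg fun e (_ : e ∈ Finset.univ) => hterm e
    have hprod := mul_nonneg (radMean_nonneg (monomial d c)) (radMean_nonneg (monomial d' c'))
    by_cases heven : ∀ i, Even ((d + d') i)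
    · have hiff (i : σ) : Even (d i) ↔ Even (d' i) := Nat.even_add.1 (heven i)
      by_cases hd : ∀ i, Even (d i)
      · refine le_add_of_le_of_nonneg (le_of_eq ?_) hsum
        have hd' : ∀ i, Even (d' i) := fun i => (hiff i).1 (hd i)
        rw [monomial_mul, radMean_monomial, radMean_monomial, radMean_monomial, if_pos hd,
          if_pos hd', if_pos heven, Nat.cast_mul, mul_one, mul_one, mul_one]
      · push Not at hd
        obtain ⟨e, he⟩ := hd
        have he' : ¬ Even (d' e) := fun h => he ((hiff e).2 h)
        rw [Nat.not_even_iff_odd] at he he'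
        exact le_add_of_nonneg_of_le hprod <|
          (radMean_monomial_mul_monomial_le_pderiv heven he he').trans <|
            Finset.single_le_sum (fun e _ => hterm e) (Finset.mem_univ e)
    · rw [monomial_mul, radMean_monomial, if_neg heven, mul_zero]
      exact add_nonneg hprod hsum
  | add_left p p' q hp hp' =>
    simp only [add_mul, map_add, Finset.sum_add_distrib]
    linarith
  | add_right p q q' hq hq' =>
    simp only [mul_add, map_add, Finset.sum_add_distrib]
    linarith

lemma radMean_X (e : σ) : radMean (X e : MvPolynomial σ ℕ) = 0 := by
  rw [X, radMean_monomial, if_neg, mul_zero]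
  exact fun h => by simpa using h e

lemma radMean_X_mul_le (e : σ) (p : MvPolynomial σ ℕ) :
    radMean (X e * p) ≤ radMean (pderiv e p) := by
  simpa [radMean_X, pderiv_X, Pi.single_apply, apply_ite radMean] using radMean_mul_le (X e) p

end RademacherMean

section SymmMatrix

variable {n : Type*} [LinearOrder n]

/-- The position in the upper triangle that carries the `(i, j)` entry of a symmetric matrix. -/
def upperIndex (i j : n) : n × n := (min i j, max i j)

lemma upperIndex_comm (i j : n) : upperIndex i j = upperIndex j i := by
  rw [upperIndex, upperIndex, min_comm, max_comm]

lemma eq_or_swap_of_upperIndex_eq {i j k l : n} (h : upperIndex k l = upperIndex i j) :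
    (k = i ∧ l = j) ∨ (k = j ∧ l = i) := by
  have hsym : s(k, l) = s(i, j) := Sym2.inf_eq_inf_and_sup_eq_sup.1 (by
    simpa only [Sym2.inf_mk, Sym2.sup_mk] using Prod.mk.inj h)
  simpa using hsym

lemma sum_ite_upperIndex_eq_le [Fintype n] {M : Type*} [AddCommMonoid M] [PartialOrder M]
    [IsOrderedAddMonoid M] {f : n → n → M} (hf : ∀ k l, 0 ≤ f k l) (i j : n) :
    ∑ k, ∑ l, (if upperIndex k l = upperIndex i j then f k l else 0) ≤ f i j + f j i := by
  calc ∑ k, ∑ l, (if upperIndex k l = upperIndex i j then f k l else 0)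
      ≤ ∑ k, ∑ l, ((if k = i then if l = j then f i j else 0 else 0) +
          if k = j then if l = i then f j i else 0 else 0) := by
        gcongr with k _ l _
        have hij := hf i j
        have hji := hf j i
        by_cases h : upperIndex k l = upperIndex i j
        · rcases eq_or_swap_of_upperIndex_eq h with ⟨rfl, rfl⟩ | ⟨rfl, rfl⟩
          · simp only [if_true]
            exact le_add_of_nonneg_right (by split_ifs <;> first | assumption | rfl)
          · simp only [upperIndex_comm, if_true]
            exact le_add_of_nonneg_left (by split_ifs <;> first | assumption | rfl)
        · rw [if_neg h]
          exact add_nonneg (by split_ifs <;> first | assumption | rfl)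
            (by split_ifs <;> first | assumption | rfl)
    _ = f i j + f j i := by simp [Finset.sum_add_distrib]

/-- The symmetric matrix with the same upper triangular part as a given array. -/
def symmMatrix {R : Type*} (y : n × n → R) : Matrix n n R :=
  Matrix.of fun i j => y (upperIndex i j)

lemma symmMatrix_apply {R : Type*} (y : n × n → R) (i j : n) :
    symmMatrix y i j = y (upperIndex i j) := rfl

lemma isSymm_symmMatrix {R : Type*} (y : n × n → R) : (symmMatrix y).IsSymm :=
  Matrix.IsSymm.ext fun i j => by rw [symmMatrix_apply, symmMatrix_apply, upperIndex_comm]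

end SymmMatrix

section MatrixDerivation

open Finset.HasAntidiagonal

variable {R A n : Type*} [CommSemiring R] [CommSemiring A] [Algebra R A] [Fintype n]

lemma map_derivation_mul (D : Derivation R A A) (P Q : Matrix n n A) :
    (P * Q).map D = P.map D * Q + P * Q.map D := by
  ext i j
  simp only [Matrix.map_apply, Matrix.mul_apply, Matrix.add_apply, map_sum, Derivation.leibniz,
    smul_eq_mul, Finset.sum_add_distrib, mul_comm (Q _ _), add_comm]

lemma map_derivation_pow_succ [DecidableEq n] (D : Derivation R A A) (P : Matrix n n A) (k : ℕ) :
    (P ^ (k + 1)).map D = ∑ ab ∈ antidiagonal k, P ^ ab.1 * P.map D * P ^ ab.2 := by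
  induction k with
  | zero => simp
  | succ k ih =>
    rw [pow_succ', map_derivation_mul, ih, Finset.Nat.antidiagonal_succ, Finset.sum_cons,
      Finset.sum_map, Finset.mul_sum]
    simp [pow_succ', mul_assoc]

lemma derivation_trace_pow_succ [DecidableEq n] (D : Derivation R A A) (P : Matrix n n A)
    (k : ℕ) : D (P ^ (k + 1)).trace = (k + 1) • (P.map D * P ^ k).trace := by
  have hcyclic : ∀ ab ∈ antidiagonal k,
      (P ^ ab.1 * P.map D * P ^ ab.2).trace = (P.map D * P ^ k).trace := by
    intro ab hab
    rw [Matrix.trace_mul_cycle, ← pow_add, add_comm, mem_antidiagonal.1 hab, Matrix.trace_mul_comm]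
  calc D (P ^ (k + 1)).trace = ((P ^ (k + 1)).map D).trace := by simp [Matrix.trace]
    _ = (k + 1) • (P.map D * P ^ k).trace := by
      rw [map_derivation_pow_succ, Matrix.trace_sum, Finset.sum_congr rfl hcyclic,
        Finset.sum_const, Finset.Nat.card_antidiagonal]

end MatrixDerivation

section TraceMoment

open MvPolynomial
open scoped BigOperators

variable (n : Type*) [LinearOrder n]

/-- The symmetric matrix whose upper triangular entries are indeterminates. -/
def genericSymm : Matrix n n (MvPolynomial (n × n) ℕ) := symmMatrix X

variable {n}

lemma map_aeval_genericSymm (y : n × n → ℝ) : (genericSymm n).map (aeval y) = symmMatrix y := by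
  ext i j
  simp [genericSymm, symmMatrix_apply]

lemma map_pderiv_genericSymm_apply (e : n × n) (k l : n) :
    (genericSymm n).map (pderiv e) k l = if upperIndex k l = e then 1 else 0 := by
  rw [Matrix.map_apply, genericSymm, symmMatrix_apply, pderiv_X, Pi.single_apply]

variable [Fintype n]

lemma genericSymm_pow_apply_comm (k : ℕ) (i j : n) :
    (genericSymm n ^ k) i j = (genericSymm n ^ k) j i :=
  ((isSymm_symmMatrix _).pow k).apply j i

lemma aeval_trace_genericSymm_pow (y : n × n → ℝ) (k : ℕ) :
    aeval y (genericSymm n ^ k).trace = (symmMatrix y ^ k).trace := by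
  have hpow : (genericSymm n ^ k).map (aeval y) = symmMatrix y ^ k := by
    rw [← map_aeval_genericSymm]
    exact map_pow (aeval y : MvPolynomial (n × n) ℕ →ₐ[ℕ] ℝ).mapMatrix (genericSymm n) k
  simp [← hpow, Matrix.trace]

/-- The symmetric matrix with entries `±1` prescribed by the upper triangular part of `x`. -/
def signMatrix (x : n × n → ℤˣ) : Matrix n n ℝ := symmMatrix (signVec x)

variable (n) in
/-- The expected trace of the `k`-th power of a symmetric matrix of independent uniform signs. -/
def traceMoment (k : ℕ) : ℝ := radMean (genericSymm n ^ k).trace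

lemma traceMoment_eq_expect (k : ℕ) :
    traceMoment n k = 𝔼 x : n × n → ℤˣ, (signMatrix x ^ k).trace := by
  simp_rw [traceMoment, radMean_apply, aeval_trace_genericSymm_pow, signMatrix]

lemma traceMoment_nonneg (k : ℕ) : 0 ≤ traceMoment n k := radMean_nonneg _

lemma traceMoment_zero : traceMoment n 0 = Fintype.card n := by
  rw [traceMoment, pow_zero, Matrix.trace_one, radMean_natCast]

lemma traceMoment_odd {k : ℕ} (hk : Odd k) : traceMoment n k = 0 := by
  have hneg (x : n × n → ℤˣ) : signMatrix (-x) = -signMatrix x := by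
    ext i j
    simp [signMatrix, symmMatrix_apply, signVec]
  have hflip : traceMoment n k = -traceMoment n k := by
    rw [traceMoment_eq_expect, ← Finset.expect_neg_distrib]
    refine Fintype.expect_equiv (Equiv.neg _) _ _ fun x => ?_
    rw [Equiv.neg_apply, hneg, hk.neg_pow, Matrix.trace_neg, neg_neg]
  linarith

lemma sum_radMean_genericSymm_pow_mul_pow (a b : ℕ) :
    ∑ i, ∑ j, radMean ((genericSymm n ^ a) i j * (genericSymm n ^ b) i j) =
      traceMoment n (a + b) := by
  simp_rw [traceMoment, pow_add, Matrix.trace, Matrix.diag, Matrix.mul_apply, map_sum,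
    genericSymm_pow_apply_comm b]

end TraceMoment

section MomentRecursion

open MvPolynomial Finset.HasAntidiagonal

variable {n : Type*} [Fintype n] [LinearOrder n]

lemma trace_map_pderiv_genericSymm_mul (e : n × n) (Q : Matrix n n (MvPolynomial (n × n) ℕ)) :
    ((genericSymm n).map (pderiv e) * Q).trace =
      ∑ k, ∑ l, if upperIndex k l = e then Q l k else 0 := by
  simp_rw [Matrix.trace, Matrix.diag, Matrix.mul_apply, map_pderiv_genericSymm_apply, ite_mul,
    one_mul, zero_mul]

lemma sum_trace_map_pderiv_genericSymm_mul (P Q : Matrix n n (MvPolynomial (n × n) ℕ)) :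
    ∑ e, ((genericSymm n).map (pderiv e) * P).trace * ((genericSymm n).map (pderiv e) * Q).trace =
      ∑ i, ∑ j, ∑ k, ∑ l,
        if upperIndex k l = upperIndex i j then P j i * Q l k else 0 := by
  simp_rw [trace_map_pderiv_genericSymm_mul, Finset.sum_mul]
  rw [Finset.sum_comm]
  refine Finset.sum_congr rfl fun i _ => ?_
  rw [Finset.sum_comm]
  refine Finset.sum_congr rfl fun j _ => ?_
  simp only [ite_mul, zero_mul, Finset.sum_ite_eq, Finset.mem_univ, if_true]
  simp only [Finset.mul_sum, mul_ite, mul_zero]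

lemma radMean_sum_ite_upperIndex_eq_le (f : n → n → MvPolynomial (n × n) ℕ) (i j : n) :
    radMean (∑ k, ∑ l, if upperIndex k l = upperIndex i j then f k l else 0) ≤
      radMean (f i j) + radMean (f j i) := by
  simp_rw [map_sum, apply_ite radMean, map_zero]
  exact sum_ite_upperIndex_eq_le (fun k l => radMean_nonneg (f k l)) i j

lemma sum_radMean_trace_map_pderiv_mul_le (a b : ℕ) :
    ∑ e, radMean (((genericSymm n).map (pderiv e) * genericSymm n ^ a).trace *
      ((genericSymm n).map (pderiv e) * genericSymm n ^ b).trace) ≤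
      2 * traceMoment n (a + b) := by
  rw [← map_sum, sum_trace_map_pderiv_genericSymm_mul, map_sum, two_mul,
    ← sum_radMean_genericSymm_pow_mul_pow, ← Finset.sum_add_distrib]
  simp_rw [map_sum radMean, ← Finset.sum_add_distrib]
  gcongr with i _ j _
  simp_rw [← map_sum radMean]
  refine (radMean_sum_ite_upperIndex_eq_le (fun k l =>
    (genericSymm n ^ a) j i * (genericSymm n ^ b) l k) i j).trans_eq ?_
  rw [genericSymm_pow_apply_comm a j i, genericSymm_pow_apply_comm b j i]

-- If `a` or `b` vanishes then so does the last term, whatever the truncated `a + b - 2` is.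
lemma radMean_trace_pow_mul_trace_pow_le (a b : ℕ) :
    radMean ((genericSymm n ^ a).trace * (genericSymm n ^ b).trace) ≤
      traceMoment n a * traceMoment n b + 2 * a * b * traceMoment n (a + b - 2) := by
  refine (radMean_mul_le _ _).trans (add_le_add_right ?_ _)
  rcases a with _ | a
  · simp [Matrix.trace_one]
  rcases b with _ | b
  · simp [Matrix.trace_one]
  calc ∑ e, radMean (pderiv e (genericSymm n ^ (a + 1)).trace *
        pderiv e (genericSymm n ^ (b + 1)).trace)
      = (a + 1) * (b + 1) *
          ∑ e, radMean (((genericSymm n).map (pderiv e) * genericSymm n ^ a).trace *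
            ((genericSymm n).map (pderiv e) * genericSymm n ^ b).trace) := by
        rw [Finset.mul_sum]
        refine Finset.sum_congr rfl fun e _ => ?_
        rw [derivation_trace_pow_succ, derivation_trace_pow_succ, smul_mul_smul_comm, map_nsmul,
          nsmul_eq_mul]
        push_cast
        rfl
    _ ≤ (a + 1) * (b + 1) * (2 * traceMoment n (a + b)) := by
        gcongr
        exact sum_radMean_trace_map_pderiv_mul_le a b
    _ = _ := by
        rw [show a + 1 + (b + 1) - 2 = a + b by omega]
        push_cast
        ring

lemma radMean_genericSymm_mul_pow_apply_le (k : ℕ) (i j : n) :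
    radMean (genericSymm n i j * (genericSymm n ^ (k + 1)) j i) ≤
      ∑ ab ∈ antidiagonal k, (radMean ((genericSymm n ^ ab.1) j i * (genericSymm n ^ ab.2) j i) +
        radMean ((genericSymm n ^ ab.1) j j * (genericSymm n ^ ab.2) i i)) := by
  refine (radMean_X_mul_le (upperIndex i j) _).trans ?_
  rw [← Matrix.map_apply (f := pderiv _) (M := genericSymm n ^ (k + 1)), map_derivation_pow_succ,
    Matrix.sum_apply, map_sum]
  gcongr with ab
  have hentry : (genericSymm n ^ ab.1 * (genericSymm n).map (pderiv (upperIndex i j)) *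
      genericSymm n ^ ab.2) j i = ∑ k, ∑ l, if upperIndex k l = upperIndex i j then
        (genericSymm n ^ ab.1) j k * (genericSymm n ^ ab.2) l i else 0 := by
    simp_rw [Matrix.mul_apply, map_pderiv_genericSymm_apply, Finset.sum_mul]
    rw [Finset.sum_comm]
    simp only [mul_ite, mul_one, mul_zero, ite_mul, zero_mul]
  rw [hentry]
  exact radMean_sum_ite_upperIndex_eq_le
    (fun k l => (genericSymm n ^ ab.1) j k * (genericSymm n ^ ab.2) l i) i j

lemma traceMoment_add_two_le (k : ℕ) :
    traceMoment n (k + 2) ≤ ∑ ab ∈ antidiagonal k, (traceMoment n k +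
      radMean ((genericSymm n ^ ab.1).trace * (genericSymm n ^ ab.2).trace)) := by
  calc traceMoment n (k + 2)
      = ∑ i, ∑ j, radMean (genericSymm n i j * (genericSymm n ^ (k + 1)) j i) := by
        rw [traceMoment, pow_succ']
        simp_rw [Matrix.trace, Matrix.diag, Matrix.mul_apply, map_sum]
    _ ≤ ∑ i, ∑ j, ∑ ab ∈ antidiagonal k,
          (radMean ((genericSymm n ^ ab.1) j i * (genericSymm n ^ ab.2) j i) +
            radMean ((genericSymm n ^ ab.1) j j * (genericSymm n ^ ab.2) i i)) := by
        gcongr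
        exact radMean_genericSymm_mul_pow_apply_le ..
    _ = _ := by
        simp_rw [Finset.sum_comm (t := antidiagonal k), Finset.sum_add_distrib]
        congr 1
        · refine Finset.sum_congr rfl fun ab hab => ?_
          rw [Finset.sum_comm, sum_radMean_genericSymm_pow_mul_pow, mem_antidiagonal.1 hab]
        · refine Finset.sum_congr rfl fun ab _ => ?_
          rw [Finset.sum_comm]
          simp_rw [Matrix.trace, Matrix.diag, Finset.sum_mul_sum, map_sum]

lemma sum_antidiagonal_two_mul {M : Type*} [AddCommMonoid M] {f : ℕ × ℕ → M}
    (hf : ∀ ab, Odd ab.1 → f ab = 0) (k : ℕ) :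
    ∑ ab ∈ antidiagonal (2 * k), f ab = ∑ ab ∈ antidiagonal k, f (2 * ab.1, 2 * ab.2) := by
  symm
  refine Finset.sum_of_injOn (fun ab => (2 * ab.1, 2 * ab.2)) ?_ ?_ ?_ fun _ _ => rfl
  · rintro ⟨a, b⟩ _ ⟨c, d⟩ _ h
    simp only [Prod.mk.injEq] at h ⊢
    omega
  · rintro ⟨a, b⟩ h
    simp only [Finset.mem_coe, mem_antidiagonal] at h ⊢
    omega
  · rintro ⟨a, b⟩ hab hrange
    rw [mem_antidiagonal] at hab
    refine hf _ (Nat.not_even_iff_odd.1 fun ⟨c, hc⟩ => hrange ⟨(c, k - c), ?_, ?_⟩)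
    · simp only [Finset.mem_coe, mem_antidiagonal]; omega
    · simp only [Prod.mk.injEq]; omega

lemma traceMoment_two_mul_succ_le (k : ℕ) :
    traceMoment n (2 * (k + 1)) ≤
      ∑ ab ∈ antidiagonal k, traceMoment n (2 * ab.1) * traceMoment n (2 * ab.2) +
        (2 * k + 1) * (traceMoment n (2 * k) + 2 * k ^ 2 * traceMoment n (2 * (k - 1))) := by
  rw [← sum_antidiagonal_two_mul (f := fun ab => traceMoment n ab.1 * traceMoment n ab.2)
    fun ab hab => by rw [traceMoment_odd hab, zero_mul]]
  calc traceMoment n (2 * k + 2)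
      ≤ ∑ ab ∈ antidiagonal (2 * k), (traceMoment n ab.1 * traceMoment n ab.2 +
          (traceMoment n (2 * k) + 2 * k ^ 2 * traceMoment n (2 * (k - 1)))) := by
        refine (traceMoment_add_two_le _).trans (Finset.sum_le_sum fun ab hab => ?_)
        have hab := mem_antidiagonal.1 hab
        have hcov := radMean_trace_pow_mul_trace_pow_le (n := n) ab.1 ab.2
        rw [show ab.1 + ab.2 - 2 = 2 * (k - 1) by omega] at hcov
        have hprod : (ab.1 * ab.2 : ℝ) ≤ k ^ 2 := by
          have : (ab.1 : ℝ) + ab.2 = 2 * k := by exact_mod_cast hab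
          nlinarith [sq_nonneg ((ab.1 : ℝ) - ab.2)]
        have := mul_le_mul_of_nonneg_right hprod (traceMoment_nonneg (n := n) (2 * (k - 1)))
        linarith
    _ = _ := by
        rw [Finset.sum_add_distrib, Finset.sum_const, Finset.Nat.card_antidiagonal, nsmul_eq_mul]
        push_cast
        rfl

lemma monotone_catalan : Monotone catalan := by
  refine monotone_nat_of_le_succ fun k => ?_
  rw [catalan_succ']
  simpa using Finset.single_le_sum (f := fun ij : ℕ × ℕ => catalan ij.1 * catalan ij.2)
    (fun _ _ => Nat.zero_le _) (mem_antidiagonal.2 (zero_add k) : (0, k) ∈ antidiagonal k)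

lemma traceMoment_two_mul_le [Nonempty n] {k K : ℕ} (hk : k ≤ K) :
    traceMoment n (2 * k) ≤ Fintype.card n ^ (k + 1) *
      (1 + (2 * K / Fintype.card n + 4 * K ^ 3 / Fintype.card n ^ 2 : ℝ)) ^ k * catalan k := by
  set N : ℝ := (Fintype.card n : ℝ)
  have hN : 0 < N := by exact Nat.cast_pos.2 Fintype.card_pos
  set ε : ℝ := 2 * K / N + 4 * K ^ 3 / N ^ 2 with hε
  have hc : 1 ≤ 1 + ε := le_add_of_nonneg_right (by positivity)
  induction k using Nat.strong_induction_on with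
  | _ k ih =>
  rcases k with _ | k
  · simp [traceMoment_zero, N]
  have hkK : (k + 1 : ℝ) ≤ K := by exact_mod_cast hk
  set B : ℝ := N ^ k * (1 + ε) ^ k * catalan (k + 1) with hB
  have hproducts :
      ∑ ab ∈ antidiagonal k, traceMoment n (2 * ab.1) * traceMoment n (2 * ab.2) ≤ N ^ 2 * B := by
    rw [hB, catalan_succ']
    push_cast
    rw [Finset.mul_sum, Finset.mul_sum]
    refine Finset.sum_le_sum fun ab hab => ?_
    obtain rfl := mem_antidiagonal.1 hab
    refine (mul_le_mul (ih ab.1 (by omega) (by omega)) (ih ab.2 (by omega) (by omega))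
      (traceMoment_nonneg _) (by positivity)).trans_eq (by ring)
  have hprev : traceMoment n (2 * k) ≤ N * B := by
    refine (ih k (by omega) (by omega)).trans ?_
    have := monotone_catalan k.le_succ
    rw [hB, ← mul_assoc, ← mul_assoc, ← pow_succ']
    gcongr
  have hprev' : k ^ 2 * traceMoment n (2 * (k - 1)) ≤ k ^ 2 * B := by
    rcases k with _ | k
    · simp
    have := monotone_catalan (show k ≤ k + 1 + 1 by omega)
    gcongr
    refine (ih k (by omega) (by omega)).trans ?_
    rw [hB]
    gcongr
    omega
  calc traceMoment n (2 * (k + 1)) ≤ N ^ 2 * B + (2 * k + 1) * (N * B + 2 * (k ^ 2 * B)) := by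
        refine (traceMoment_two_mul_succ_le k).trans ?_
        rw [mul_assoc 2 ((k : ℝ) ^ 2)]
        gcongr
    _ ≤ N ^ 2 * B + 2 * K * (N * B + 2 * (K ^ 2 * B)) := by gcongr <;> linarith
    _ = N ^ 2 * B * (1 + ε) := by rw [hε]; field_simp; ring
    _ = _ := by rw [hB]; ring

end MomentRecursion

section FirstPassage

open Finset.HasAntidiagonal

variable {R n : Type*} [DecidableEq n]

/-- The matrix `P` with all entries outside `S × S` replaced by zero: its powers count the walks
that stay inside `S`. -/
def restrictMatrix [Zero R] (S : Finset n) (P : Matrix n n R) : Matrix n n R :=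
  Matrix.of fun i j => if i ∈ S ∧ j ∈ S then P i j else 0

lemma restrictMatrix_apply [Zero R] (S : Finset n) (P : Matrix n n R) (i j : n) :
    restrictMatrix S P i j = if i ∈ S ∧ j ∈ S then P i j else 0 := rfl

lemma restrictMatrix_restrictMatrix [Zero R] (S T : Finset n) (P : Matrix n n R) :
    restrictMatrix T (restrictMatrix S P) = restrictMatrix (S ∩ T) P := by
  ext i j
  simp only [restrictMatrix_apply, Finset.mem_inter]
  grind

lemma restrictMatrix_univ [Zero R] [Fintype n] (P : Matrix n n R) :
    restrictMatrix Finset.univ P = P := by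
  ext i j
  simp [restrictMatrix_apply]

-- The walks from `w` to `v` are split according to their first visit to `v`.
lemma matrix_pow_succ_apply_first_passage [CommSemiring R] [Fintype n] (P : Matrix n n R)
    {v w : n} (hw : w ≠ v) (m : ℕ) :
    (P ^ (m + 1)) w v =
      ∑ ab ∈ antidiagonal m, (restrictMatrix {v}ᶜ P ^ ab.1 * P) w v * (P ^ ab.2) v v := by
  induction m generalizing w with
  | zero => simp
  | succ m ih =>
    have hstep : ∑ u ∈ Finset.univ.erase v, P w u * (P ^ (m + 1)) u v =
        ∑ u, restrictMatrix {v}ᶜ P w u * ∑ ab ∈ antidiagonal m,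
          (restrictMatrix {v}ᶜ P ^ ab.1 * P) u v * (P ^ ab.2) v v := by
      rw [← Finset.sum_erase Finset.univ (a := v) (by simp [restrictMatrix_apply])]
      refine Finset.sum_congr rfl fun u hu => ?_
      have huv := Finset.ne_of_mem_erase hu
      rw [ih huv, restrictMatrix_apply, if_pos (by simp [hw, huv])]
    rw [Finset.Nat.antidiagonal_succ, Finset.sum_cons, Finset.sum_map, pow_succ', Matrix.mul_apply,
      ← Finset.add_sum_erase _ _ (Finset.mem_univ v), hstep]
    congr 1
    · simp
    · simp_rw [Finset.mul_sum]
      rw [Finset.sum_comm]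
      refine Finset.sum_congr rfl fun ab _ => ?_
      simp only [Function.Embedding.prodMap, Function.Embedding.coeFn_mk, Prod.map,
        Function.Embedding.refl_apply]
      rw [Nat.succ_eq_add_one, pow_succ', Matrix.mul_assoc, Matrix.mul_apply, Finset.sum_mul]
      simp_rw [mul_assoc]

end FirstPassage

section MomentLowerBound

open MvPolynomial Finset.HasAntidiagonal

variable {n : Type*} [Fintype n] [LinearOrder n]

lemma radMean_X_mul_X {σ : Type*} [Fintype σ] [DecidableEq σ] (e : σ) :
    radMean (X e * X e : MvPolynomial σ ℕ) = 1 := by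
  rw [X, monomial_mul, radMean_monomial, if_pos fun i => ⟨_, Finsupp.add_apply _ _ i⟩]
  simp

lemma radMean_entry_mul_apply_mul_ge {S : Finset n} {v w : n} (hv : v ∈ S) (hw : w ∈ S)
    (Q : Matrix n n (MvPolynomial (n × n) ℕ)) (p : MvPolynomial (n × n) ℕ) :
    radMean (Q w w) * radMean p ≤ radMean (restrictMatrix S (genericSymm n) v w *
      ((Q * restrictMatrix S (genericSymm n)) w v * p)) := by
  have hvw : restrictMatrix S (genericSymm n) v w = X (upperIndex v w) := by
    rw [restrictMatrix_apply, if_pos ⟨hv, hw⟩, genericSymm, symmMatrix_apply]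
  have hwv : restrictMatrix S (genericSymm n) w v = X (upperIndex v w) := by
    rw [restrictMatrix_apply, if_pos ⟨hw, hv⟩, genericSymm, symmMatrix_apply, upperIndex_comm]
  calc radMean (Q w w) * radMean p
      ≤ radMean (X (upperIndex v w) * X (upperIndex v w)) * radMean (Q w w * p) := by
        rw [radMean_X_mul_X, one_mul]
        exact radMean_mul_radMean_le _ _
    _ ≤ radMean (X (upperIndex v w) * X (upperIndex v w) * (Q w w * p)) :=
        radMean_mul_radMean_le _ _
    _ = radMean (restrictMatrix S (genericSymm n) v w *
          (Q w w * restrictMatrix S (genericSymm n) w v * p)) := by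
        rw [hvw, hwv]; congr 1; ring
    _ ≤ _ := by
        rw [Matrix.mul_apply, ← Finset.add_sum_erase _ _ (Finset.mem_univ w), add_mul, mul_add,
          map_add]
        exact le_add_of_nonneg_right (radMean_nonneg _)

lemma sum_radMean_mul_radMean_le_first_step {S : Finset n} {v w : n} (hv : v ∈ S)
    (hw : w ∈ S.erase v) (k : ℕ) :
    ∑ ab ∈ antidiagonal k, radMean ((restrictMatrix (S.erase v) (genericSymm n) ^ (2 * ab.1)) w w) *
        radMean ((restrictMatrix S (genericSymm n) ^ (2 * ab.2)) v v) ≤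
      radMean (restrictMatrix S (genericSymm n) v w *
        (restrictMatrix S (genericSymm n) ^ (2 * k + 1)) w v) := by
  obtain ⟨hwv, hwS⟩ := Finset.mem_erase.1 hw
  rw [matrix_pow_succ_apply_first_passage _ hwv, restrictMatrix_restrictMatrix,
    ← Finset.sdiff_eq_inter_compl, Finset.sdiff_singleton_eq_erase, Finset.mul_sum, map_sum]
  let f : ℕ × ℕ → ℝ := fun ab => if Even ab.1 then radMean (restrictMatrix S (genericSymm n) v w *
    ((restrictMatrix (S.erase v) (genericSymm n) ^ ab.1 * restrictMatrix S (genericSymm n)) w v *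
      (restrictMatrix S (genericSymm n) ^ ab.2) v v)) else 0
  have hf : ∀ ab : ℕ × ℕ, Odd ab.1 → f ab = 0 := fun ab hab => if_neg (Nat.not_even_iff_odd.2 hab)
  calc _ ≤ ∑ ab ∈ antidiagonal k, f (2 * ab.1, 2 * ab.2) := by
        refine Finset.sum_le_sum fun ab _ => ?_
        simp only [f, even_two_mul, if_true]
        exact radMean_entry_mul_apply_mul_ge hv hwS _ _
    _ = ∑ ab ∈ antidiagonal (2 * k), f ab := (sum_antidiagonal_two_mul hf k).symm
    _ ≤ _ := by
        refine Finset.sum_le_sum fun ab _ => ?_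
        simp only [f]
        split_ifs
        · exact le_rfl
        · exact radMean_nonneg _

-- A closed walk from `v` that steps to a new vertex `w`, makes a closed excursion from `w`
-- avoiding `v`, returns along the same edge and then makes another closed walk contributes to the
-- expectation; these walks satisfy the Catalan recursion.
lemma catalan_le_radMean_restrictMatrix (k : ℕ) (S : Finset n) {v : n} (hv : v ∈ S) :
    ((S.card - k : ℕ) : ℝ) ^ k * catalan k ≤
      radMean ((restrictMatrix S (genericSymm n) ^ (2 * k)) v v) := by
  induction k using Nat.strong_induction_on generalizing S v with
  | _ k ih =>
  rcases k with _ | k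
  · simpa using (radMean_natCast (σ := n × n) 1).ge
  set s : ℕ := S.card - (k + 1)
  have hneighbour : ∀ w ∈ S.erase v, (s : ℝ) ^ k * catalan (k + 1) ≤
      radMean (restrictMatrix S (genericSymm n) v w *
        (restrictMatrix S (genericSymm n) ^ (2 * k + 1)) w v) := by
    intro w hw
    refine le_trans ?_ (sum_radMean_mul_radMean_le_first_step hv hw k)
    rw [catalan_succ', Nat.cast_sum, Finset.mul_sum]
    refine Finset.sum_le_sum fun ab hab => ?_
    have hab := mem_antidiagonal.1 hab
    have hexcursion := ih ab.1 (by omega) (S.erase v) hw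
    have hrest := ih ab.2 (by omega) S hv
    rw [Finset.card_erase_of_mem hv] at hexcursion
    have hcard₁ : s ≤ S.card - 1 - ab.1 := by omega
    have hcard₂ : s ≤ S.card - ab.2 := by omega
    calc (s : ℝ) ^ k * (catalan ab.1 * catalan ab.2 : ℕ)
        = (s ^ ab.1 * catalan ab.1) * (s ^ ab.2 * catalan ab.2) := by
          rw [← hab]; push_cast; ring
      _ ≤ (((S.card - 1 - ab.1 : ℕ) : ℝ) ^ ab.1 * catalan ab.1) *
          (((S.card - ab.2 : ℕ) : ℝ) ^ ab.2 * catalan ab.2) := by gcongr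
      _ ≤ _ := mul_le_mul hexcursion hrest (by positivity) (radMean_nonneg _)
  have hcard : (s : ℝ) ≤ (S.erase v).card := by
    rw [Finset.card_erase_of_mem hv]
    exact_mod_cast (by omega : s ≤ S.card - 1)
  rw [show 2 * (k + 1) = (2 * k + 1) + 1 by ring, pow_succ' (restrictMatrix S _), Matrix.mul_apply,
    map_sum]
  calc (s : ℝ) ^ (k + 1) * catalan (k + 1)
      ≤ (S.erase v).card * ((s : ℝ) ^ k * catalan (k + 1)) := by
        rw [pow_succ', mul_assoc]; gcongr
    _ ≤ ∑ w ∈ S.erase v, radMean (restrictMatrix S (genericSymm n) v w *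
          (restrictMatrix S (genericSymm n) ^ (2 * k + 1)) w v) := by
        rw [← nsmul_eq_mul]
        exact Finset.card_nsmul_le_sum _ _ _ hneighbour
    _ ≤ _ := Finset.sum_le_sum_of_subset_of_nonneg (Finset.subset_univ _)
        fun _ _ _ => radMean_nonneg _

lemma catalan_le_traceMoment (k : ℕ) :
    (Fintype.card n : ℝ) * ((Fintype.card n - k : ℕ) : ℝ) ^ k * catalan k ≤
      traceMoment n (2 * k) := by
  rw [traceMoment, Matrix.trace, map_sum, mul_assoc, ← nsmul_eq_mul, ← Finset.card_univ]
  refine Finset.card_nsmul_le_sum _ _ _ fun v hv => ?_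
  simpa only [restrictMatrix_univ, Matrix.diag_apply] using
    catalan_le_radMean_restrictMatrix k Finset.univ hv

end MomentLowerBound

/-! ### Norm of a random sign matrix -/

section NormTrace

open scoped Matrix.Norms.L2Operator

lemma norm_pow_of_isSelfAdjoint {A : Type*} [NormedRing A] [NormOneClass A] [StarRing A]
    [CStarRing A] {a : A} (ha : IsSelfAdjoint a) (k : ℕ) : ‖a ^ k‖ = ‖a‖ ^ k := by
  refine le_antisymm (norm_pow_le a k) ?_
  rcases eq_or_ne a 0 with rfl | ha0
  · rcases k with _ | k <;> simp
  have hk : k ≤ 2 ^ k := Nat.lt_two_pow_self.le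
  have hpos : 0 < ‖a‖ := norm_pos_iff.2 ha0
  refine le_of_mul_le_mul_right ?_ (pow_pos hpos (2 ^ k - k))
  calc ‖a‖ ^ k * ‖a‖ ^ (2 ^ k - k) = ‖a ^ k * a ^ (2 ^ k - k)‖ := by
        rw [← pow_add, ← pow_add, Nat.add_sub_cancel' hk, ha.norm_pow_two_pow]
    _ ≤ ‖a ^ k‖ * ‖a‖ ^ (2 ^ k - k) :=
        (norm_mul_le _ _).trans (by gcongr; exact norm_pow_le _ _)

lemma euclideanOpNorm_eq_norm {N : ℕ} (A : Matrix (Fin N) (Fin N) ℝ) :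
    euclideanOpNorm A = ‖A‖ := rfl

variable {n : Type*} [Fintype n] [DecidableEq n]

lemma norm_sq_le_sum_sq (B : Matrix n n ℝ) : ‖B‖ ^ 2 ≤ ∑ i, ∑ j, B i j ^ 2 := by
  rw [← Real.le_sqrt (norm_nonneg _) (by positivity)]
  rw [Matrix.cstar_norm_def]
  refine ContinuousLinearMap.opNorm_le_bound _ (Real.sqrt_nonneg _) fun x => ?_
  rw [EuclideanSpace.norm_eq, EuclideanSpace.norm_eq, ← Real.sqrt_mul (by positivity)]
  refine Real.sqrt_le_sqrt ?_
  simp_rw [Matrix.ofLp_toEuclideanCLM, Real.norm_eq_abs, sq_abs, Matrix.mulVec, dotProduct]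
  rw [Finset.sum_mul]
  exact Finset.sum_le_sum fun _ _ => Finset.sum_mul_sq_le_sq_mul_sq _ _ _

lemma sum_sq_col_le (B : Matrix n n ℝ) (j : n) : ∑ i, B i j ^ 2 ≤ ‖B‖ ^ 2 := by
  have h := Matrix.l2_opNorm_mulVec B (EuclideanSpace.single j (1 : ℝ))
  rw [PiLp.norm_single, norm_one, mul_one, EuclideanSpace.norm_eq] at h
  refine (Real.sqrt_le_left (norm_nonneg _)).1 ?_
  simpa using h

lemma abs_apply_le_norm (B : Matrix n n ℝ) (i j : n) : |B i j| ≤ ‖B‖ :=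
  abs_le_of_sq_le_sq ((Finset.single_le_sum (f := fun i => B i j ^ 2) (fun _ _ => sq_nonneg _)
    (Finset.mem_univ i)).trans (sum_sq_col_le B j)) (norm_nonneg _)

lemma trace_pow_two_mul {A : Matrix n n ℝ} (hA : A.IsSymm) (k : ℕ) :
    (A ^ (2 * k)).trace = ∑ i, ∑ j, (A ^ k) i j ^ 2 := by
  rw [two_mul, pow_add, Matrix.trace]
  simp_rw [Matrix.diag, Matrix.mul_apply, sq]
  refine Finset.sum_congr rfl fun i _ => Finset.sum_congr rfl fun j _ => ?_
  rw [(hA.pow k).apply]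

lemma norm_pow_of_isSymm [Nonempty n] {A : Matrix n n ℝ} (hA : A.IsSymm) (k : ℕ) :
    ‖A ^ k‖ = ‖A‖ ^ k :=
  norm_pow_of_isSelfAdjoint (Matrix.isHermitian_iff_isSymm.2 hA) k

lemma norm_pow_le_trace [Nonempty n] {A : Matrix n n ℝ} (hA : A.IsSymm) (k : ℕ) :
    ‖A‖ ^ (2 * k) ≤ (A ^ (2 * k)).trace := by
  rw [trace_pow_two_mul hA, mul_comm, pow_mul, ← norm_pow_of_isSymm hA k]
  exact norm_sq_le_sum_sq _

lemma trace_pow_le [Nonempty n] {A : Matrix n n ℝ} (hA : A.IsSymm) (k : ℕ) :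
    (A ^ (2 * k)).trace ≤ Fintype.card n * ‖A‖ ^ (2 * k) := by
  rw [trace_pow_two_mul hA, mul_comm 2 k, pow_mul, ← norm_pow_of_isSymm hA k, Finset.sum_comm]
  refine (Finset.sum_le_sum fun j _ => sum_sq_col_le _ j).trans_eq ?_
  rw [Finset.sum_const, nsmul_eq_mul, Finset.card_univ]

lemma norm_vecMulVec (x y : n → ℝ) :
    ‖Matrix.vecMulVec x y‖ = ‖WithLp.toLp 2 x‖ * ‖WithLp.toLp 2 y‖ := by
  rw [← InnerProductSpace.norm_rankOne (𝕜 := ℝ), Matrix.cstar_norm_def]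
  congr 1
  ext z i
  simp [Matrix.vecMulVec, Matrix.mulVec, dotProduct, PiLp.inner_apply, Finset.mul_sum, mul_comm,
    mul_assoc]

lemma norm_all_ones : ‖(Matrix.of fun _ _ => 1 : Matrix n n ℝ)‖ = Fintype.card n := by
  have h : (Matrix.of fun _ _ => 1 : Matrix n n ℝ) = Matrix.vecMulVec 1 1 := by
    ext i j
    simp [Matrix.vecMulVec_apply]
  have hone : ‖WithLp.toLp 2 (1 : n → ℝ)‖ = √(Fintype.card n) := by
    simp [EuclideanSpace.norm_eq]
  rw [h, norm_vecMulVec, hone, Real.mul_self_sqrt (Nat.cast_nonneg _)]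

end NormTrace

section Density

open scoped BigOperators

variable {α : Type*} [Fintype α]

lemma dens_mul_le_expect {B : Finset α} {f : α → ℝ} {c : ℝ} (hf : ∀ x, 0 ≤ f x)
    (hB : ∀ x ∈ B, c ≤ f x) : (B.dens : ℝ) * c ≤ 𝔼 x, f x := by
  rw [Finset.nnratCast_dens, Fintype.expect_eq_sum_div_card, div_mul_eq_mul_div, ← nsmul_eq_mul]
  gcongr
  exact (Finset.card_nsmul_le_sum _ _ _ hB).trans
    (Finset.sum_le_sum_of_subset_of_nonneg (Finset.subset_univ _) fun x _ _ => hf x)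

lemma expect_le_add_mul_dens {B : Finset α} {f : α → ℝ} {a b : ℝ} (ha : 0 ≤ a)
    (hBc : ∀ x ∉ B, f x ≤ a) (hB : ∀ x ∈ B, f x ≤ b) : 𝔼 x, f x ≤ a + b * B.dens := by
  classical
  have hsum : ∑ x, f x ≤ Fintype.card α * a + B.card * b := by
    rw [← Finset.sum_add_sum_compl B, add_comm, ← nsmul_eq_mul, ← nsmul_eq_mul]
    gcongr
    · refine (Finset.sum_le_card_nsmul Bᶜ f a fun x hx => hBc x (Finset.mem_compl.1 hx)).trans ?_
      gcongr
      exact Finset.card_le_univ _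
    · exact Finset.sum_le_card_nsmul B f b hB
  rcases isEmpty_or_nonempty α with hα | hα
  · simp [Finset.eq_empty_of_isEmpty B, ha]
  rw [Finset.nnratCast_dens, Fintype.expect_eq_sum_div_card, div_le_iff₀ (by positivity)]
  refine hsum.trans_eq ?_
  field_simp

end Density

section UpperTail

open Asymptotics
open scoped BigOperators Matrix.Norms.L2Operator

variable {n : Type*} [Fintype n] [LinearOrder n]

variable (n) in
/-- The sign configurations whose symmetric matrix has operator norm at least `s`. -/
def largeNormConfigs (s : ℝ) : Finset (n × n → ℤˣ) :=
  open Classical in {x | s ≤ ‖signMatrix x‖}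

lemma mem_largeNormConfigs {s : ℝ} {x : n × n → ℤˣ} :
    x ∈ largeNormConfigs n s ↔ s ≤ ‖signMatrix x‖ := by
  simp [largeNormConfigs]

lemma dens_largeNormConfigs_mul_pow_le [Nonempty n] (k : ℕ) {s : ℝ} (hs : 0 ≤ s) :
    (largeNormConfigs n s).dens * s ^ (2 * k) ≤ traceMoment n (2 * k) := by
  have hnorm (x : n × n → ℤˣ) : ‖signMatrix x‖ ^ (2 * k) ≤ (signMatrix x ^ (2 * k)).trace :=
    norm_pow_le_trace (isSymm_symmMatrix _) k
  rw [traceMoment_eq_expect]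
  refine dens_mul_le_expect (fun x => (by positivity : (0 : ℝ) ≤ _).trans (hnorm x)) fun x hx => ?_
  refine le_trans ?_ (hnorm x)
  gcongr
  exact mem_largeNormConfigs.1 hx

lemma catalan_le_four_pow (k : ℕ) : catalan k ≤ 4 ^ k :=
  calc catalan k ≤ (k + 1) * catalan k := Nat.le_mul_of_pos_left _ k.succ_pos
    _ = k.centralBinom := succ_mul_catalan_eq_centralBinom k
    _ ≤ 4 ^ k := k.centralBinom_le_four_pow

lemma traceMoment_two_mul_le_of_sq_le {k : ℕ} (hk : 0 < k) (hkn : k ^ 2 ≤ Fintype.card n) :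
    traceMoment n (2 * k) ≤ Fintype.card n * (4 * (1 + 6 / k) * Fintype.card n) ^ k := by
  have hcard : 0 < Fintype.card n := lt_of_lt_of_le (by positivity) hkn
  have : Nonempty n := Fintype.card_pos_iff.1 hcard
  have hc := traceMoment_two_mul_le (n := n) (le_refl k)
  set N : ℝ := (Fintype.card n : ℝ) with hN
  have hN0 : 0 < N := by rw [hN]; exact_mod_cast hcard
  have hk0 : (0 : ℝ) < k := by exact_mod_cast hk
  have hkN : (k : ℝ) ^ 2 ≤ N := by rw [hN]; exact_mod_cast hkn
  have hlinear : 2 * k / N ≤ 2 / k := by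
    rw [div_le_div_iff₀ hN0 hk0]
    linarith
  have hcubic : 4 * k ^ 3 / N ^ 2 ≤ 4 / k := by
    rw [div_le_div_iff₀ (by positivity) hk0]
    calc 4 * (k : ℝ) ^ 3 * k = 4 * ((k : ℝ) ^ 2) ^ 2 := by ring
      _ ≤ 4 * N ^ 2 := by gcongr
  have hsum : (2 / k + 4 / k : ℝ) = 6 / k := by ring
  calc traceMoment n (2 * k)
      ≤ N ^ (k + 1) * (1 + (2 * k / N + 4 * k ^ 3 / N ^ 2)) ^ k * catalan k := hc
    _ ≤ N ^ (k + 1) * (1 + 6 / k) ^ k * (4 : ℝ) ^ k := by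
        gcongr
        · linarith
        · exact_mod_cast catalan_le_four_pow k
    _ = N * (4 * (1 + 6 / k) * N) ^ k := by
        rw [mul_pow, mul_pow]
        ring

lemma tendsto_natSqrt_atTop : Tendsto Nat.sqrt atTop atTop :=
  tendsto_atTop.2 fun b => by
    filter_upwards [eventually_ge_atTop (b * b)] with n hn
    exact Nat.le_sqrt.2 hn

lemma superpolynomialDecay_pow_natSqrt {ρ : ℝ} (h0 : 0 < ρ) (h1 : ρ < 1) :
    SuperpolynomialDecay atTop (fun N : ℕ => (N : ℝ)) fun N => ρ ^ N.sqrt := by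
  intro m
  have h := ((tendsto_pow_const_mul_const_pow_of_abs_lt_one (2 * m)
    (by rwa [abs_of_pos h0] : |ρ| < 1)).comp
    ((tendsto_add_atTop_nat 1).comp tendsto_natSqrt_atTop)).const_mul ρ⁻¹
  rw [mul_zero] at h
  refine squeeze_zero (fun N => by positivity) (fun N => ?_) h
  have hN : (N : ℝ) ≤ ((N.sqrt + 1 : ℕ) : ℝ) ^ 2 := by
    exact_mod_cast (Nat.lt_succ_sqrt' N).le
  calc (N : ℝ) ^ m * ρ ^ N.sqrt ≤ (((N.sqrt + 1 : ℕ) : ℝ) ^ 2) ^ m * ρ ^ N.sqrt := by gcongr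
    _ = ρ⁻¹ * (((N.sqrt + 1 : ℕ) : ℝ) ^ (2 * m) * ρ ^ (N.sqrt + 1)) := by
        rw [pow_succ ρ, ← pow_mul]
        field_simp

lemma dens_largeNormConfigs_le {k : ℕ} (hk : 0 < k) (hkn : k ^ 2 ≤ Fintype.card n) {a ρ : ℝ}
    (ha : 0 < a) (hρ : 4 * (1 + 6 / k) ≤ ρ * a ^ 2) :
    (largeNormConfigs n (a * √(Fintype.card n))).dens ≤ Fintype.card n * ρ ^ k := by
  have hcard : 0 < Fintype.card n := lt_of_lt_of_le (by positivity) hkn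
  have : Nonempty n := Fintype.card_pos_iff.1 hcard
  set N : ℝ := (Fintype.card n : ℝ) with hN
  have hN0 : 0 < N := by rw [hN]; exact_mod_cast hcard
  refine le_of_mul_le_mul_right ?_ (by positivity : 0 < (a * √N) ^ (2 * k))
  calc (largeNormConfigs n (a * √N)).dens * (a * √N) ^ (2 * k)
      ≤ N * (4 * (1 + 6 / k) * N) ^ k :=
        (dens_largeNormConfigs_mul_pow_le k (by positivity)).trans
          (traceMoment_two_mul_le_of_sq_le hk hkn)
    _ ≤ N * (ρ * a ^ 2 * N) ^ k := by gcongr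
    _ = N * ρ ^ k * (a * √N) ^ (2 * k) := by
        rw [pow_mul, mul_pow a, Real.sq_sqrt hN0.le, mul_assoc ρ, mul_pow ρ, mul_assoc]

theorem superpolynomialDecay_dens_largeNormConfigs {a : ℝ} (ha : 2 < a) :
    SuperpolynomialDecay atTop (fun N : ℕ => (N : ℝ))
      fun N => ((largeNormConfigs (Fin N) (a * √N)).dens : ℝ) := by
  have ha0 : 0 < a := two_pos.trans ha
  obtain ⟨ρ, hρa, hρ1⟩ := exists_between
    (by rw [div_lt_one (by positivity)]; nlinarith : 4 / a ^ 2 < 1)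
  have hρ0 : 0 < ρ := lt_trans (by positivity) hρa
  have hlim : Tendsto (fun N : ℕ => 4 * (1 + 6 / (N.sqrt : ℝ))) atTop (𝓝 (4 * (1 + 0))) :=
    (((tendsto_const_div_atTop_nhds_zero_nat 6).comp tendsto_natSqrt_atTop).const_add 1).const_mul 4
  rw [add_zero, mul_one] at hlim
  refine SuperpolynomialDecay.trans_eventuallyLE (.of_forall fun N => N.cast_nonneg)
    (superpolynomialDecay_zero _ _) (superpolynomialDecay_pow_natSqrt hρ0 hρ1).param_mul
    (.of_forall fun N => NNRat.cast_nonneg _) ?_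
  filter_upwards [hlim.eventually_le_const ((div_lt_iff₀ (by positivity)).1 hρa),
    tendsto_natSqrt_atTop.eventually_gt_atTop 0] with N hN hK
  have h := dens_largeNormConfigs_le (n := Fin N) hK (by simpa using Nat.sqrt_le' N) ha0 hN
  simpa only [Fintype.card_fin, Pi.mul_apply] using h

end UpperTail

section CubeConcentration

open scoped BigOperators

lemma exp_add_exp_div_two_le {a b l : ℝ} (h : |a - b| ≤ 1) :
    (Real.exp (l * a) + Real.exp (l * b)) / 2 ≤ Real.exp (l * ((a + b) / 2) + l ^ 2 / 8) := by
  have hcosh : (Real.exp (l * a) + Real.exp (l * b)) / 2 =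
      Real.exp (l * ((a + b) / 2)) * Real.cosh (l * (a - b) / 2) := by
    rw [Real.cosh_eq, mul_div_assoc', mul_add, ← Real.exp_add, ← Real.exp_add]
    ring_nf
  have hsq : (a - b) ^ 2 ≤ 1 := (sq_le_one_iff_abs_le_one _).2 h
  rw [hcosh, Real.exp_add]
  gcongr
  refine (Real.cosh_le_exp_half_sq _).trans (Real.exp_le_exp.2 ?_)
  nlinarith [mul_nonneg (sq_nonneg l) (sub_nonneg.2 hsq)]

lemma expect_signs_succ {m : ℕ} (f : (Fin (m + 1) → ℤˣ) → ℝ) :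
    𝔼 x, f x = 𝔼 y : Fin m → ℤˣ, (f (Fin.cons 1 y) + f (Fin.cons (-1) y)) / 2 := by
  have hsum : ∑ x, f x = ∑ y : Fin m → ℤˣ, (f (Fin.cons 1 y) + f (Fin.cons (-1) y)) := by
    rw [← (Fin.consEquiv fun _ => ℤˣ).sum_comp, Fintype.sum_prod_type_right]
    simp [Fin.consEquiv, UnitsInt.univ]
  simp_rw [Fintype.expect_eq_sum_div_card, hsum, ← Finset.sum_div, card_signs, Fintype.card_fin,
    pow_succ]
  push_cast
  field_simp

lemma expect_exp_le_fin (l : ℝ) {m : ℕ} (g : (Fin m → ℤˣ) → ℝ)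
    (hg : ∀ x i s, |g (Function.update x i s) - g x| ≤ 1) :
    𝔼 x, Real.exp (l * g x) ≤ Real.exp (l * (𝔼 x, g x) + l ^ 2 / 8 * m) := by
  induction m with
  | zero => simp
  | succ m ih =>
    set h : (Fin m → ℤˣ) → ℝ := fun y => (g (Fin.cons 1 y) + g (Fin.cons (-1) y)) / 2 with hh
    have hLip : ∀ x i s, |h (Function.update x i s) - h x| ≤ 1 := by
      intro x i s
      have h₁ := hg (Fin.cons 1 x) i.succ s
      have h₂ := hg (Fin.cons (-1) x) i.succ s
      rw [← Fin.cons_update, abs_le] at h₁ h₂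
      rw [abs_le]
      simp only [hh]
      constructor <;> linarith
    have hfirst (y : Fin m → ℤˣ) : |g (Fin.cons 1 y) - g (Fin.cons (-1) y)| ≤ 1 := by
      simpa only [Fin.update_cons_zero] using hg (Fin.cons (-1) y) 0 1
    calc 𝔼 x, Real.exp (l * g x) ≤ 𝔼 y, Real.exp (l * h y + l ^ 2 / 8) := by
          rw [expect_signs_succ]
          exact Finset.expect_le_expect fun y _ => exp_add_exp_div_two_le (hfirst y)
      _ = Real.exp (l ^ 2 / 8) * 𝔼 y, Real.exp (l * h y) := by
          simp_rw [Real.exp_add, Finset.mul_expect, mul_comm]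
      _ ≤ Real.exp (l ^ 2 / 8) * Real.exp (l * (𝔼 y, h y) + l ^ 2 / 8 * m) := by
          gcongr
          exact ih h hLip
      _ = _ := by
          rw [← Real.exp_add, expect_signs_succ g, hh]
          push_cast
          ring_nf

variable {σ : Type*} [Fintype σ] [DecidableEq σ]

lemma expect_exp_le (l : ℝ) (g : (σ → ℤˣ) → ℝ)
    (hg : ∀ x i s, |g (Function.update x i s) - g x| ≤ 1) :
    𝔼 x, Real.exp (l * g x) ≤ Real.exp (l * (𝔼 x, g x) + l ^ 2 / 8 * Fintype.card σ) := by
  let e := Fintype.equivFin σ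
  have hreindex (f : (σ → ℤˣ) → ℝ) : 𝔼 y : Fin (Fintype.card σ) → ℤˣ, f (y ∘ e) = 𝔼 x, f x :=
    Fintype.expect_equiv (Equiv.arrowCongr e.symm (Equiv.refl ℤˣ)) _ _ fun _ => rfl
  have h := expect_exp_le_fin l (fun y => g (y ∘ e)) (fun x i s => by
    rw [Function.update_comp_equiv]
    exact hg _ _ _)
  rwa [hreindex (fun x => Real.exp (l * g x)), hreindex g] at h

/-- The Hamming distance to a nonempty set of configurations. -/
def hammingInfDist {B : Finset (σ → ℤˣ)} (hB : B.Nonempty) (x : σ → ℤˣ) : ℕ :=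
  B.inf' hB fun y => hammingDist x y

omit [DecidableEq σ] in
lemma hammingInfDist_le_add {B : Finset (σ → ℤˣ)} (hB : B.Nonempty) (x y : σ → ℤˣ) :
    hammingInfDist hB x ≤ hammingDist x y + hammingInfDist hB y := by
  obtain ⟨z, hz, hyz⟩ := Finset.exists_mem_eq_inf' hB fun z => hammingDist y z
  rw [hammingInfDist, hammingInfDist, hyz]
  exact (Finset.inf'_le _ hz).trans (hammingDist_triangle x y z)

lemma hammingDist_update_le (x : σ → ℤˣ) (i : σ) (s : ℤˣ) :
    hammingDist (Function.update x i s) x ≤ 1 := by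
  refine (Finset.card_le_card (t := {i}) fun j hj => ?_).trans_eq (Finset.card_singleton i)
  by_contra h
  simp_all

lemma abs_hammingInfDist_update_sub_le {B : Finset (σ → ℤˣ)} (hB : B.Nonempty) (x : σ → ℤˣ)
    (i : σ) (s : ℤˣ) :
    |(hammingInfDist hB (Function.update x i s) : ℝ) - hammingInfDist hB x| ≤ 1 := by
  have h₁ := hammingInfDist_le_add hB (Function.update x i s) x
  have h₂ := hammingInfDist_le_add hB x (Function.update x i s)
  rw [hammingDist_comm] at h₂
  have h₃ := hammingDist_update_le x i s
  rw [abs_sub_le_iff, sub_le_iff_le_add, sub_le_iff_le_add]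
  constructor <;> norm_cast <;> omega

/-- The configurations at Hamming distance at least `D` from every point of `B`. -/
def farFrom (B : Finset (σ → ℤˣ)) (D : ℝ) : Finset (σ → ℤˣ) :=
  open Classical in {x | ∀ y ∈ B, D ≤ hammingDist x y}

lemma mem_farFrom {B : Finset (σ → ℤˣ)} {D : ℝ} {x : σ → ℤˣ} :
    x ∈ farFrom B D ↔ ∀ y ∈ B, D ≤ hammingDist x y := by
  simp [farFrom]

lemma dens_mul_dens_farFrom_le (B : Finset (σ → ℤˣ)) {D : ℝ} (hD : 0 ≤ D) :
    (B.dens * (farFrom B D).dens : ℝ) ≤ Real.exp (-(D ^ 2 / Fintype.card σ)) := by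
  rcases B.eq_empty_or_nonempty with rfl | hB
  · simpa using (Real.exp_pos _).le
  set g : (σ → ℤˣ) → ℝ := fun x => hammingInfDist hB x
  set l : ℝ := 2 * D / Fintype.card σ with hl
  have hnear : (B.dens * 1 : ℝ) ≤ 𝔼 x, Real.exp (-l * g x) := by
    refine dens_mul_le_expect (fun x => (Real.exp_pos _).le) fun x hx => ?_
    have hzero : hammingInfDist hB x = 0 := by
      simpa [hammingInfDist] using Finset.inf'_le (fun y => hammingDist x y) hx
    simp [g, hzero]
  have hfar : (farFrom B D).dens * Real.exp (l * D) ≤ 𝔼 x, Real.exp (l * g x) := by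
    refine dens_mul_le_expect (fun x => (Real.exp_pos _).le) fun x hx => ?_
    obtain ⟨z, hz, hxz⟩ := Finset.exists_mem_eq_inf' hB fun z => hammingDist x z
    have hDg : D ≤ g x := by
      simp only [g, hammingInfDist, hxz]
      exact mem_farFrom.1 hx z hz
    gcongr
  have hprod := mul_le_mul
    (hnear.trans (expect_exp_le (-l) g (abs_hammingInfDist_update_sub_le hB)))
    (hfar.trans (expect_exp_le l g (abs_hammingInfDist_update_sub_le hB)))
    (by positivity) (by positivity)
  rw [mul_one, ← mul_assoc, ← Real.exp_add, ← le_div_iff₀ (Real.exp_pos _), ← Real.exp_sub] at hprod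
  refine hprod.trans_eq (congrArg Real.exp ?_)
  rcases eq_or_ne (Fintype.card σ) 0 with hσ | hσ
  · simp [hl, hσ]
  · rw [hl]
    field_simp
    ring

end CubeConcentration

section TracePerturbation

open Finset.HasAntidiagonal
open scoped Matrix.Norms.L2Operator

lemma pow_succ_sub_pow_succ {R : Type*} [Ring R] (a b : R) (m : ℕ) :
    a ^ (m + 1) - b ^ (m + 1) = ∑ ij ∈ antidiagonal m, a ^ ij.1 * (a - b) * b ^ ij.2 := by
  induction m with
  | zero => simp
  | succ m ih =>
    have hstep : a ^ (m + 1 + 1) - b ^ (m + 1 + 1) =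
        (a - b) * b ^ (m + 1) + a * (a ^ (m + 1) - b ^ (m + 1)) := by
      rw [pow_succ' a, pow_succ' b]
      noncomm_ring
    rw [Finset.Nat.antidiagonal_succ, Finset.sum_cons, Finset.sum_map, hstep, ih, Finset.mul_sum]
    simp [pow_succ' a, mul_assoc]

variable {n : Type*} [Fintype n]

section Norm

variable [DecidableEq n]

lemma trace_mul_le_norm_mul_sum_abs (A B : Matrix n n ℝ) :
    (A * B).trace ≤ ‖B‖ * ∑ i, ∑ j, |A i j| := by
  simp_rw [Matrix.trace, Matrix.diag, Matrix.mul_apply, Finset.mul_sum]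
  refine Finset.sum_le_sum fun i _ => Finset.sum_le_sum fun j _ => ?_
  calc A i j * B j i ≤ |A i j| * |B j i| := (le_abs_self _).trans_eq (abs_mul _ _)
    _ ≤ |A i j| * ‖B‖ := by
        gcongr
        exact abs_apply_le_norm B j i
    _ = ‖B‖ * |A i j| := mul_comm _ _

lemma trace_pow_succ_sub_le [Nonempty n] {A B : Matrix n n ℝ} {R : ℝ} (hA : ‖A‖ ≤ R)
    (hB : ‖B‖ ≤ R) (m : ℕ) :
    (A ^ (m + 1)).trace - (B ^ (m + 1)).trace ≤ (m + 1) * R ^ m * ∑ i, ∑ j, |(A - B) i j| := by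
  have hR : 0 ≤ R := (norm_nonneg _).trans hA
  have hterm : ∀ ij ∈ antidiagonal m, (A ^ ij.1 * (A - B) * B ^ ij.2).trace ≤
      R ^ m * ∑ i, ∑ j, |(A - B) i j| := by
    intro ij hij
    have hnorm : ‖B ^ ij.2 * A ^ ij.1‖ ≤ R ^ m := by
      rw [← mem_antidiagonal.1 hij, add_comm, pow_add]
      refine (norm_mul_le _ _).trans ?_
      gcongr
      · exact (norm_pow_le _ _).trans (by gcongr)
      · exact (norm_pow_le _ _).trans (by gcongr)
    rw [Matrix.mul_assoc, Matrix.trace_mul_comm, Matrix.mul_assoc]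
    refine (trace_mul_le_norm_mul_sum_abs _ _).trans ?_
    gcongr
  rw [← Matrix.trace_sub, pow_succ_sub_pow_succ, Matrix.trace_sum]
  refine (Finset.sum_le_card_nsmul _ _ _ hterm).trans_eq ?_
  rw [Finset.Nat.card_antidiagonal, nsmul_eq_mul]
  push_cast
  ring

end Norm

variable [LinearOrder n]

lemma sum_abs_signMatrix_sub_le (x y : n × n → ℤˣ) :
    ∑ i, ∑ j, |(signMatrix x - signMatrix y) i j| ≤ 4 * hammingDist x y := by
  let u (e : n × n) : ℝ := if x e ≠ y e then 1 else 0
  have hu : ∑ i, ∑ j, u (i, j) = hammingDist x y := by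
    rw [← Fintype.sum_prod_type' (f := fun i j => u (i, j))]
    simp only [u, Finset.sum_boole, hammingDist]
  have hu0 (e) : 0 ≤ u e := by positivity
  have hval (s t : ℤˣ) : |((s : ℤ) : ℝ) - ((t : ℤ) : ℝ)| ≤ 2 * if s ≠ t then 1 else 0 := by
    rcases Int.units_eq_one_or s with rfl | rfl <;> rcases Int.units_eq_one_or t with rfl | rfl <;>
      norm_num
  have hentry (i j : n) : |(signMatrix x - signMatrix y) i j| ≤ 2 * (u (i, j) + u (j, i)) := by
    have hdiff : |(signMatrix x - signMatrix y) i j| ≤ 2 * u (upperIndex i j) := hval _ _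
    refine hdiff.trans (mul_le_mul_of_nonneg_left ?_ two_pos.le)
    rcases le_total i j with h | h
    · simpa [upperIndex, h] using hu0 (j, i)
    · simpa [upperIndex, h] using hu0 (i, j)
  calc ∑ i, ∑ j, |(signMatrix x - signMatrix y) i j|
      ≤ ∑ i, ∑ j, 2 * (u (i, j) + u (j, i)) := by
        gcongr with i _ j _
        exact hentry i j
    _ = 4 * hammingDist x y := by
        simp_rw [← Finset.mul_sum, Finset.sum_add_distrib]
        rw [Finset.sum_comm (f := fun i j => u (j, i)), hu]
        ring

lemma norm_signMatrix_le (x : n × n → ℤˣ) : ‖signMatrix x‖ ≤ Fintype.card n := by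
  refine abs_le_of_sq_le_sq' ?_ (by positivity) |>.2
  have hsq (i j : n) : signMatrix x i j ^ 2 = 1 := by
    rcases Int.units_eq_one_or (x (upperIndex i j)) with h | h <;>
      simp [signMatrix, symmMatrix_apply, signVec, h]
  refine (norm_sq_le_sum_sq _).trans_eq ?_
  simp [hsq, sq]

end TracePerturbation

section LowerTail

open Asymptotics
open scoped BigOperators Matrix.Norms.L2Operator

lemma exists_pow_lt_catalan {a : ℝ} (ha : 0 ≤ a) (ha2 : a < 2) :
    ∃ k : ℕ, 0 < k ∧ a ^ (2 * k) < catalan k := by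
  have hr : |a ^ 2 / 4| < 1 := by
    rw [abs_of_nonneg (by positivity)]
    nlinarith
  obtain ⟨k, hk, hk0⟩ := (((tendsto_pow_const_mul_const_pow_of_abs_lt_one 2 hr).eventually_lt_const
    (by norm_num : (0 : ℝ) < 1 / 4)).and (eventually_gt_atTop 0)).exists
  have hk1 : (1 : ℝ) ≤ k := by exact_mod_cast hk0
  have hcentral : (4 : ℝ) ^ k ≤ 2 * k * ((k + 1) * catalan k) := by
    have h := Nat.four_pow_le_two_mul_self_mul_centralBinom k hk0
    rw [← succ_mul_catalan_eq_centralBinom] at h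
    exact_mod_cast h
  refine ⟨k, hk0, lt_of_mul_lt_mul_left ?_ (by positivity : (0 : ℝ) ≤ 4 * k ^ 2)⟩
  rw [div_pow, ← pow_mul, mul_div_assoc', div_lt_iff₀ (by positivity)] at hk
  calc 4 * (k : ℝ) ^ 2 * a ^ (2 * k) < 4 ^ k := by linarith
    _ ≤ 2 * k * ((k + k) * catalan k) := hcentral.trans (by gcongr)
    _ = 4 * k ^ 2 * catalan k := by ring

variable {n : Type*} [Fintype n] [LinearOrder n]

variable (n) in
/-- The sign configurations whose symmetric matrix has operator norm at most `s`. -/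
def smallNormConfigs (s : ℝ) : Finset (n × n → ℤˣ) :=
  open Classical in {x | ‖signMatrix x‖ ≤ s}

lemma mem_smallNormConfigs {s : ℝ} {x : n × n → ℤˣ} :
    x ∈ smallNormConfigs n s ↔ ‖signMatrix x‖ ≤ s := by
  simp [smallNormConfigs]

lemma trace_pow_le_of_hammingDist_le [Nonempty n] {x y : n × n → ℤˣ} {a b η : ℝ} (hab : a ≤ b)
    (hx : ‖signMatrix x‖ ≤ b * √(Fintype.card n)) (hy : ‖signMatrix y‖ ≤ a * √(Fintype.card n))
    (hxy : hammingDist x y ≤ η * (Fintype.card n * √(Fintype.card n))) (k : ℕ) :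
    (signMatrix x ^ (2 * (k + 1))).trace ≤ (Fintype.card n : ℝ) ^ (k + 2) *
      (a ^ (2 * (k + 1)) + 8 * (k + 1) * b ^ (2 * k + 1) * η) := by
  set N : ℝ := (Fintype.card n : ℝ)
  have hN0 : 0 ≤ N := Nat.cast_nonneg _
  have hb : 0 ≤ b * √N := (norm_nonneg _).trans hx
  have hperturb : (signMatrix x ^ (2 * (k + 1))).trace - (signMatrix y ^ (2 * (k + 1))).trace ≤
      (2 * (k + 1)) * (b * √N) ^ (2 * k + 1) * (4 * (η * (N * √N))) := by
    calc _ ≤ ((2 * k + 1 : ℕ) + 1) * (b * √N) ^ (2 * k + 1) *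
          ∑ i, ∑ j, |(signMatrix x - signMatrix y) i j| :=
          trace_pow_succ_sub_le hx (hy.trans (by gcongr)) (2 * k + 1)
      _ ≤ ((2 * k + 1 : ℕ) + 1) * (b * √N) ^ (2 * k + 1) * (4 * (η * (N * √N))) := by
          gcongr
          exact (sum_abs_signMatrix_sub_le x y).trans (by gcongr)
      _ = _ := by
          push_cast
          ring
  have hsmall : (signMatrix y ^ (2 * (k + 1))).trace ≤ N * (a * √N) ^ (2 * (k + 1)) :=
    (trace_pow_le (isSymm_symmMatrix _) _).trans (by gcongr; exact hy)
  have hsqrt (m : ℕ) : √N ^ (2 * m) = N ^ m := by rw [pow_mul, Real.sq_sqrt hN0]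
  calc (signMatrix x ^ (2 * (k + 1))).trace
      ≤ N * (a * √N) ^ (2 * (k + 1)) +
          (2 * (k + 1)) * (b * √N) ^ (2 * k + 1) * (4 * (η * (N * √N))) := by linarith
    _ = N * a ^ (2 * (k + 1)) * √N ^ (2 * (k + 1)) +
          8 * (k + 1) * b ^ (2 * k + 1) * η * N * √N ^ (2 * (k + 1)) := by ring
    _ = _ := by
        rw [hsqrt]
        ring

-- A configuration either has a matrix of large norm, or is far from every configuration with a
-- small norm, or is close to one of the latter, which makes the trace of its powers small.
lemma traceMoment_le_of_farFrom [Nonempty n] {a b η : ℝ} (ha : 0 ≤ a) (hab : a ≤ b)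
    (hη : 0 ≤ η) (k : ℕ) :
    traceMoment n (2 * (k + 1)) ≤ (Fintype.card n : ℝ) ^ (k + 2) *
        (a ^ (2 * (k + 1)) + 8 * (k + 1) * b ^ (2 * k + 1) * η) +
      (Fintype.card n : ℝ) ^ (2 * k + 3) *
        ((farFrom (smallNormConfigs n (a * √(Fintype.card n)))
            (η * (Fintype.card n * √(Fintype.card n)))).dens +
          (largeNormConfigs n (b * √(Fintype.card n))).dens) := by
  have hb : 0 ≤ b := ha.trans hab
  set F := farFrom (smallNormConfigs n (a * √(Fintype.card n)))
    (η * (Fintype.card n * √(Fintype.card n)))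
  set L := largeNormConfigs n (b * √(Fintype.card n))
  have hdens : ((F ∪ L).dens : ℝ) ≤ F.dens + L.dens := by exact_mod_cast Finset.dens_union_le F L
  rw [traceMoment_eq_expect]
  refine (expect_le_add_mul_dens (B := F ∪ L) (by positivity) (fun x hx => ?_)
    fun x _ => ?_).trans (add_le_add_right (mul_le_mul_of_nonneg_left hdens (by positivity)) _)
  · obtain ⟨hxF, hxL⟩ := not_or.1 (Finset.mem_union.not.1 hx)
    simp only [F, mem_farFrom, not_forall, not_le] at hxF
    obtain ⟨y, hy, hxy⟩ := hxF
    exact trace_pow_le_of_hammingDist_le hab (not_le.1 (mem_largeNormConfigs.not.1 hxL)).le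
      (mem_smallNormConfigs.1 hy) hxy.le k
  · refine (trace_pow_le (isSymm_symmMatrix _) _).trans ?_
    calc (Fintype.card n : ℝ) * ‖signMatrix x‖ ^ (2 * (k + 1))
        ≤ Fintype.card n * (Fintype.card n : ℝ) ^ (2 * (k + 1)) := by
          gcongr
          exact norm_signMatrix_le x
      _ = _ := by ring

lemma tendsto_natCast_sub_div_pow (k l : ℕ) :
    Tendsto (fun N : ℕ => (((N - k : ℕ) : ℝ) / N) ^ l) atTop (𝓝 1) := by
  have h : Tendsto (fun N : ℕ => ((N - k : ℕ) : ℝ) / N) atTop (𝓝 (1 - 0)) := by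
    refine ((tendsto_const_div_atTop_nhds_zero_nat (k : ℝ)).const_sub 1).congr' ?_
    filter_upwards [eventually_ge_atTop k, eventually_gt_atTop 0] with N hkN hN
    rw [Nat.cast_sub hkN]
    field_simp
  simpa using h.pow l

-- Otherwise the `2k`-th trace moment would be too small compared with the Catalan number.
lemma exists_eventually_le_dens_farFrom {a : ℝ} (ha : 0 ≤ a) (ha2 : a < 2) :
    ∃ (k : ℕ) (η c : ℝ), 0 < η ∧ 0 < c ∧ ∀ᶠ N : ℕ in atTop,
      c ≤ (N : ℝ) ^ k * (farFrom (smallNormConfigs (Fin N) (a * √N)) (η * (N * √N))).dens := by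
  obtain ⟨k, hk, hgap⟩ := exists_pow_lt_catalan ha ha2
  obtain ⟨k, rfl⟩ := Nat.exists_eq_add_one_of_ne_zero hk.ne'
  set δ : ℝ := catalan (k + 1) - a ^ (2 * (k + 1))
  have hδ0 : 0 < δ := sub_pos.2 hgap
  set η : ℝ := δ / (16 * (k + 1) * 3 ^ (2 * k + 1)) with hη
  have hη' : 8 * (k + 1) * 3 ^ (2 * k + 1) * η = δ / 2 := by
    rw [hη]
    field_simp
    norm_num
  refine ⟨k + 1, η, δ / 4, by positivity, by positivity, ?_⟩
  have hcatalan := (tendsto_natCast_sub_div_pow (k + 1) (k + 1)).mul_const (catalan (k + 1) : ℝ)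
  rw [one_mul] at hcatalan
  have hlarge := superpolynomialDecay_dens_largeNormConfigs (by norm_num : (2 : ℝ) < 3) (k + 1)
  filter_upwards [hcatalan.eventually_const_le (by linarith : catalan (k + 1) - δ / 8 < _),
    hlarge.eventually_le_const (by linarith : 0 < δ / 8), eventually_gt_atTop 0] with N h₁ h₂ hN
  have : Nonempty (Fin N) := ⟨⟨0, hN⟩⟩
  have : (0 : ℝ) < N := by exact_mod_cast hN
  have hmoment := (catalan_le_traceMoment (n := Fin N) (k + 1)).trans
    (traceMoment_le_of_farFrom ha (by linarith : a ≤ 3) (by positivity : 0 ≤ η) k)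
  rw [hη', Fintype.card_fin] at hmoment
  have hscaled : (((N - (k + 1) : ℕ) : ℝ) / N) ^ (k + 1) * catalan (k + 1) ≤
      (a ^ (2 * (k + 1)) + δ / 2) + (N : ℝ) ^ (k + 1) *
        ((farFrom (smallNormConfigs (Fin N) (a * √N)) (η * (N * √N))).dens +
          (largeNormConfigs (Fin N) (3 * √N)).dens) := by
    refine le_of_mul_le_mul_left ?_ (by positivity : (0 : ℝ) < N ^ (k + 2))
    refine le_trans (le_of_eq ?_) (hmoment.trans_eq (by ring))
    rw [div_pow]
    field_simp
    ring
  linarith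

theorem superpolynomialDecay_dens_smallNormConfigs {a : ℝ} (ha : 0 ≤ a) (ha2 : a < 2) :
    SuperpolynomialDecay atTop (fun N : ℕ => (N : ℝ))
      fun N => ((smallNormConfigs (Fin N) (a * √N)).dens : ℝ) := by
  obtain ⟨k, η, c, hη, hc, hfar⟩ := exists_eventually_le_dens_farFrom ha ha2
  have hexp : SuperpolynomialDecay atTop (fun N : ℕ => (N : ℝ))
      fun N => Real.exp (-η ^ 2) ^ N := fun m =>
    tendsto_pow_const_mul_const_pow_of_abs_lt_one m (by
      rw [abs_of_pos (Real.exp_pos _), Real.exp_lt_one_iff]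
      exact neg_neg_of_pos (by positivity))
  refine SuperpolynomialDecay.trans_eventuallyLE (.of_forall fun N => N.cast_nonneg)
    (superpolynomialDecay_zero _ _) ((hexp.param_pow_mul k).const_mul c⁻¹)
    (.of_forall fun N => NNRat.cast_nonneg _) ?_
  filter_upwards [hfar, eventually_gt_atTop 0] with N hN hN0
  have hN0' : (0 : ℝ) < N := by exact_mod_cast hN0
  have hconc := dens_mul_dens_farFrom_le (smallNormConfigs (Fin N) (a * √N))
    (by positivity : 0 ≤ η * (N * √N))
  have hexponent : -((η * (N * √N)) ^ 2 / Fintype.card (Fin N × Fin N)) = N * -η ^ 2 := by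
    rw [Fintype.card_prod, Fintype.card_fin, mul_pow, mul_pow, Real.sq_sqrt hN0'.le]
    push_cast
    field_simp
  rw [hexponent, Real.exp_nat_mul] at hconc
  simp only [Pi.mul_apply, Pi.pow_apply]
  rw [inv_mul_eq_div, le_div_iff₀ hc]
  calc _ ≤ _ := mul_le_mul_of_nonneg_left hN (NNRat.cast_nonneg _)
    _ = (N : ℝ) ^ k * _ := mul_left_comm _ _ _
    _ ≤ _ := mul_le_mul_of_nonneg_left hconc (by positivity)

end LowerTail

/-! ### Curie-Weiss law as a mixture -/

section CurieWeissLaw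

variable {ι : Type*} [Fintype ι]

lemma curieWeissWeight_pos (β : ℝ) (x : ι → ℤˣ) : 0 < curieWeissWeight β x := Real.exp_pos _

lemma one_le_curieWeissWeight {β : ℝ} (hβ : 0 ≤ β) (x : ι → ℤˣ) : 1 ≤ curieWeissWeight β x :=
  Real.one_le_exp (by positivity)

variable [DecidableEq ι]

lemma curieWeissPartition_pos (β : ℝ) : 0 < curieWeissPartition ι β :=
  Finset.sum_pos (fun x _ => curieWeissWeight_pos β x) Finset.univ_nonempty

lemma two_pow_card_le_curieWeissPartition {β : ℝ} (hβ : 0 ≤ β) :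
    2 ^ Fintype.card ι ≤ curieWeissPartition ι β := by
  have h := Finset.card_nsmul_le_sum (Finset.univ : Finset (ι → ℤˣ)) (curieWeissWeight β) 1
    fun x _ => one_le_curieWeissWeight hβ x
  rwa [Finset.card_univ, card_signs, nsmul_one, Nat.cast_pow, Nat.cast_ofNat] at h

/-- The Curie-Weiss probability of a set of spin configurations. -/
def curieWeissProb (β : ℝ) (B : Finset (ι → ℤˣ)) : ℝ :=
  (curieWeissPartition ι β)⁻¹ * ∑ x ∈ B, curieWeissWeight β x

lemma curieWeissProb_nonneg (β : ℝ) (B : Finset (ι → ℤˣ)) : 0 ≤ curieWeissProb β B :=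
  mul_nonneg (inv_nonneg.2 (curieWeissPartition_pos β).le)
    (Finset.sum_nonneg fun x _ => (curieWeissWeight_pos β x).le)

lemma curieWeissProb_univ (β : ℝ) : curieWeissProb β (Finset.univ : Finset (ι → ℤˣ)) = 1 :=
  inv_mul_cancel₀ (curieWeissPartition_pos β).ne'

namespace IsCurieWeiss

variable {Ω : Type*} [MeasurableSpace Ω] {P : Measure Ω} {β : ℝ} {ξ : ι → Ω → ℝ}

lemma measurableSet_config (h : IsCurieWeiss P β ξ) (x : ι → ℤˣ) :
    MeasurableSet {ω | ∀ i, ξ i ω = signVec x i} := by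
  rw [Set.ofPred_forall]
  exact .iInter fun i => h.measurable i (measurableSet_singleton _)

lemma measure_biUnion_config (h : IsCurieWeiss P β ξ) (B : Finset (ι → ℤˣ)) :
    P (⋃ x ∈ B, {ω | ∀ i, ξ i ω = signVec x i}) = ENNReal.ofReal (curieWeissProb β B) := by
  have hdisj : (B : Set (ι → ℤˣ)).PairwiseDisjoint fun x => {ω | ∀ i, ξ i ω = signVec x i} := by
    refine fun x _ y _ hxy => Set.disjoint_left.2 fun ω hx hy => hxy (funext fun i => ?_)
    exact Units.ext (Int.cast_injective ((hx i).symm.trans (hy i)))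
  rw [measure_biUnion_finset hdisj fun x _ => h.measurableSet_config x, curieWeissProb,
    Finset.mul_sum, ENNReal.ofReal_sum_of_nonneg fun x _ => mul_nonneg
      (inv_nonneg.2 (curieWeissPartition_pos β).le) (curieWeissWeight_pos β x).le]
  exact Finset.sum_congr rfl fun x _ => h.prob_eq x

lemma ae_exists_eq_signVec [IsProbabilityMeasure P] (h : IsCurieWeiss P β ξ) :
    ∀ᵐ ω ∂P, ∃ x : ι → ℤˣ, ∀ i, ξ i ω = signVec x i := by
  have hone := h.measure_biUnion_config Finset.univ
  rw [curieWeissProb_univ, ENNReal.ofReal_one, ← mem_ae_iff_prob_eq_one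
    (Finset.measurableSet_biUnion _ fun x _ => h.measurableSet_config x)] at hone
  filter_upwards [hone] with ω hω
  simpa using hω

lemma measure_le [IsProbabilityMeasure P] (h : IsCurieWeiss P β ξ) {S : Set (ι → ℝ)}
    {B : Finset (ι → ℤˣ)} (hB : ∀ x, signVec x ∈ S → x ∈ B) :
    P {ω | (fun i => ξ i ω) ∈ S} ≤ ENNReal.ofReal (curieWeissProb β B) := by
  rw [← h.measure_biUnion_config B]
  refine measure_mono_ae ?_
  filter_upwards [h.ae_exists_eq_signVec] with ω ⟨x, hx⟩ hω
  exact Set.mem_iUnion₂.2 ⟨x, hB x (funext hx ▸ hω), hx⟩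

end IsCurieWeiss

end CurieWeissLaw

section GaussianMixture

lemma exp_neg_mul_sq_mul_exp_mul {b : ℝ} (hb : b ≠ 0) (s y : ℝ) :
    Real.exp (-b * y ^ 2) * Real.exp (y * s) =
      Real.exp (s ^ 2 / (4 * b)) * Real.exp (-b * (y - s / (2 * b)) ^ 2) := by
  rw [← Real.exp_add, ← Real.exp_add]
  congr 1
  field_simp
  ring

lemma integrable_exp_neg_mul_sq_mul_exp_mul {b : ℝ} (hb : 0 < b) (s : ℝ) :
    Integrable fun y : ℝ => Real.exp (-b * y ^ 2) * Real.exp (y * s) := by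
  simp_rw [exp_neg_mul_sq_mul_exp_mul hb.ne']
  exact ((integrable_exp_neg_mul_sq hb).comp_sub_right _).const_mul _

lemma integral_exp_neg_mul_sq_mul_exp_mul {b : ℝ} (hb : b ≠ 0) (s : ℝ) :
    ∫ y : ℝ, Real.exp (-b * y ^ 2) * Real.exp (y * s) =
      √(Real.pi / b) * Real.exp (s ^ 2 / (4 * b)) := by
  simp_rw [exp_neg_mul_sq_mul_exp_mul hb]
  rw [integral_const_mul, integral_sub_right_eq_self (fun y => Real.exp (-b * y ^ 2)),
    integral_gaussian, mul_comm]

/-- The probability of the value `s` for a spin of mean `tanh y`. -/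
def tiltedSpinWeight (y : ℝ) (s : ℤˣ) : ℝ := Real.exp (y * ((s : ℤ) : ℝ)) / (2 * Real.cosh y)

/-- The probability of `x` under the product law with independent spins of mean `tanh y`. -/
def tiltedWeight {ι : Type*} [Fintype ι] (y : ℝ) (x : ι → ℤˣ) : ℝ :=
  ∏ i, tiltedSpinWeight y (x i)

/-- The probability of a set of configurations of independent spins of mean `tanh y`. -/
def tiltedProb {ι : Type*} [Fintype ι] (y : ℝ) (B : Finset (ι → ℤˣ)) : ℝ :=
  ∑ x ∈ B, tiltedWeight y x

/-- The function whose `M`-th power is, up to normalization, the density of the law of `y` under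
which the mixture of the product laws with spin mean `tanh y` is the Curie-Weiss law of `M`
spins. -/
def mixingDensity (β y : ℝ) : ℝ := Real.cosh y * Real.exp (-(y ^ 2 / (2 * β)))

lemma tiltedSpinWeight_nonneg (y : ℝ) (s : ℤˣ) : 0 ≤ tiltedSpinWeight y s :=
  div_nonneg (Real.exp_pos _).le (by positivity [Real.cosh_pos y])

lemma sum_tiltedSpinWeight_mul (y : ℝ) (f : ℤˣ → ℝ) :
    ∑ s, tiltedSpinWeight y s * f s =
      (Real.exp y * f 1 + Real.exp (-y) * f (-1)) / (2 * Real.cosh y) := by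
  rw [UnitsInt.univ, Finset.sum_pair (by decide)]
  simp only [tiltedSpinWeight, Units.val_one, Int.cast_one, mul_one, Units.val_neg, Int.cast_neg,
    mul_neg]
  ring

lemma sum_tiltedSpinWeight (y : ℝ) : ∑ s, tiltedSpinWeight y s = 1 := by
  have h := sum_tiltedSpinWeight_mul y fun _ => 1
  simp only [mul_one] at h
  rw [h, div_eq_one_iff_eq (by positivity [Real.cosh_pos y]), Real.cosh_eq]
  ring

lemma sum_tiltedSpinWeight_mul_self (y : ℝ) :
    ∑ s : ℤˣ, tiltedSpinWeight y s * ((s : ℤ) : ℝ) = Real.tanh y := by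
  rw [sum_tiltedSpinWeight_mul, Real.tanh_eq_sinh_div_cosh, Real.sinh_eq, div_div]
  push_cast
  ring

lemma mixingDensity_pos (β y : ℝ) : 0 < mixingDensity β y :=
  mul_pos (Real.cosh_pos y) (Real.exp_pos _)

lemma continuous_mixingDensity (β : ℝ) : Continuous (mixingDensity β) := by
  unfold mixingDensity
  fun_prop

variable {ι : Type*} [Fintype ι]

lemma tiltedWeight_nonneg (y : ℝ) (x : ι → ℤˣ) : 0 ≤ tiltedWeight y x :=
  Finset.prod_nonneg fun _ _ => tiltedSpinWeight_nonneg y _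

lemma mixingDensity_pow_mul_tiltedWeight (β y : ℝ) (x : ι → ℤˣ) :
    mixingDensity β y ^ Fintype.card ι * tiltedWeight y x =
      (2 ^ Fintype.card ι)⁻¹ * (Real.exp (-(Fintype.card ι / (2 * β)) * y ^ 2) *
        Real.exp (y * ∑ i, signVec x i)) := by
  have := (Real.cosh_pos y).ne'
  simp only [tiltedWeight, tiltedSpinWeight, signVec]
  rw [Finset.prod_div_distrib, Finset.prod_const, Finset.card_univ, ← Real.exp_sum,
    ← Finset.mul_sum, mixingDensity, mul_pow, mul_pow, ← Real.exp_nat_mul,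
    show (Fintype.card ι : ℝ) * -(y ^ 2 / (2 * β)) = -(Fintype.card ι / (2 * β)) * y ^ 2 by ring]
  field_simp

lemma integrable_mixingDensity_pow_mul_tiltedWeight [Nonempty ι] {β : ℝ} (hβ : 0 < β)
    (x : ι → ℤˣ) : Integrable fun y => mixingDensity β y ^ Fintype.card ι * tiltedWeight y x := by
  simp_rw [mixingDensity_pow_mul_tiltedWeight]
  exact (integrable_exp_neg_mul_sq_mul_exp_mul (by positivity) _).const_mul _

lemma integral_mixingDensity_pow_mul_tiltedWeight [Nonempty ι] {β : ℝ} (hβ : 0 < β)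
    (x : ι → ℤˣ) :
    ∫ y, mixingDensity β y ^ Fintype.card ι * tiltedWeight y x =
      √(Real.pi / (Fintype.card ι / (2 * β))) / 2 ^ Fintype.card ι * curieWeissWeight β x := by
  have hweight : curieWeissWeight β x =
      Real.exp ((∑ i, signVec x i) ^ 2 / (4 * (Fintype.card ι / (2 * β)))) := by
    simp only [curieWeissWeight, signVec]
    congr 1
    field_simp
    ring
  simp_rw [mixingDensity_pow_mul_tiltedWeight]
  rw [integral_const_mul, integral_exp_neg_mul_sq_mul_exp_mul (by positivity), hweight]
  ring

lemma integrable_mixingDensity_pow_mul_tiltedProb [Nonempty ι] {β : ℝ} (hβ : 0 < β)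
    (B : Finset (ι → ℤˣ)) :
    Integrable fun y => mixingDensity β y ^ Fintype.card ι * tiltedProb y B := by
  simp_rw [tiltedProb, Finset.mul_sum]
  exact integrable_finsetSum _ fun x _ => integrable_mixingDensity_pow_mul_tiltedWeight hβ x

lemma integral_mixingDensity_pow_mul_tiltedProb [Nonempty ι] {β : ℝ} (hβ : 0 < β)
    (B : Finset (ι → ℤˣ)) :
    ∫ y, mixingDensity β y ^ Fintype.card ι * tiltedProb y B =
      √(Real.pi / (Fintype.card ι / (2 * β))) / 2 ^ Fintype.card ι *
        ∑ x ∈ B, curieWeissWeight β x := by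
  simp_rw [tiltedProb, Finset.mul_sum]
  rw [integral_finsetSum _ fun x _ => integrable_mixingDensity_pow_mul_tiltedWeight hβ x]
  exact Finset.sum_congr rfl fun x _ => integral_mixingDensity_pow_mul_tiltedWeight hβ x

variable [DecidableEq ι]

lemma sum_tiltedWeight_mul_prod (y : ℝ) (f : ι → ℤˣ → ℝ) :
    ∑ x : ι → ℤˣ, tiltedWeight y x * ∏ i, f i (x i) =
      ∏ i, ∑ s, tiltedSpinWeight y s * f i s := by
  simp_rw [tiltedWeight, ← Finset.prod_mul_distrib]
  exact (Fintype.prod_sum fun i s => tiltedSpinWeight y s * f i s).symm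

lemma sum_tiltedWeight (y : ℝ) : ∑ x : ι → ℤˣ, tiltedWeight y x = 1 := by
  simpa only [Finset.prod_const_one, mul_one, sum_tiltedSpinWeight] using
    sum_tiltedWeight_mul_prod (ι := ι) y fun _ _ => 1

lemma tiltedProb_univ (y : ℝ) : tiltedProb y (Finset.univ : Finset (ι → ℤˣ)) = 1 :=
  sum_tiltedWeight y

omit [DecidableEq ι] in
lemma tiltedProb_le_one (y : ℝ) (B : Finset (ι → ℤˣ)) : tiltedProb y B ≤ 1 := by
  classical
  rw [← tiltedProb_univ (ι := ι) y]
  exact Finset.sum_le_sum_of_subset_of_nonneg (Finset.subset_univ _)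
    fun x _ _ => tiltedWeight_nonneg y x

lemma integral_mixingDensity_pow [Nonempty ι] {β : ℝ} (hβ : 0 < β) :
    ∫ y, mixingDensity β y ^ Fintype.card ι =
      √(Real.pi / (Fintype.card ι / (2 * β))) / 2 ^ Fintype.card ι * curieWeissPartition ι β := by
  simpa only [tiltedProb_univ, mul_one, curieWeissPartition] using
    integral_mixingDensity_pow_mul_tiltedProb hβ (Finset.univ : Finset (ι → ℤˣ))

lemma integrable_mixingDensity_pow {β : ℝ} (hβ : 0 < β) {M : ℕ} (hM : M ≠ 0) :
    Integrable fun y => mixingDensity β y ^ M := by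
  have : NeZero M := ⟨hM⟩
  simpa only [tiltedProb_univ, mul_one, Fintype.card_fin] using
    integrable_mixingDensity_pow_mul_tiltedProb hβ (Finset.univ : Finset (Fin M → ℤˣ))

lemma integral_mixingDensity_pow_pos {β : ℝ} (hβ : 0 < β) {M : ℕ} (hM : M ≠ 0) :
    0 < ∫ y, mixingDensity β y ^ M := by
  have : NeZero M := ⟨hM⟩
  have h := integral_mixingDensity_pow (ι := Fin M) hβ
  have := curieWeissPartition_pos (ι := Fin M) β
  rw [Fintype.card_fin] at h
  rw [h]
  positivity

lemma curieWeissProb_eq_integral_div [Nonempty ι] {β : ℝ} (hβ : 0 < β) (B : Finset (ι → ℤˣ)) :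
    curieWeissProb β B = (∫ y, mixingDensity β y ^ Fintype.card ι * tiltedProb y B) /
      ∫ y, mixingDensity β y ^ Fintype.card ι := by
  rw [integral_mixingDensity_pow_mul_tiltedProb hβ, integral_mixingDensity_pow hβ,
    mul_div_mul_left _ _ (by positivity), curieWeissProb, inv_mul_eq_div]

lemma curieWeissProb_le_of_tiltedProb_le [Nonempty ι] {β : ℝ} (hβ : 0 < β)
    {B : Finset (ι → ℤˣ)} {K : Set ℝ} (hK : MeasurableSet K) {δ : ℝ} (hδ : 0 ≤ δ)
    (h : ∀ y ∈ K, tiltedProb y B ≤ δ) :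
    curieWeissProb β B ≤ δ + (∫ y in Kᶜ, mixingDensity β y ^ Fintype.card ι) /
      ∫ y, mixingDensity β y ^ Fintype.card ι := by
  have hint := integrable_mixingDensity_pow hβ (Fintype.card_ne_zero (α := ι))
  have hintB := integrable_mixingDensity_pow_mul_tiltedProb hβ B
  have hpos (y : ℝ) : 0 ≤ mixingDensity β y ^ Fintype.card ι :=
    (pow_pos (mixingDensity_pos β y) _).le
  have htotal := integral_mixingDensity_pow_pos hβ (Fintype.card_ne_zero (α := ι))
  rw [curieWeissProb_eq_integral_div hβ, div_le_iff₀ htotal, add_mul,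
    div_mul_cancel₀ _ htotal.ne', ← integral_add_compl hK hintB]
  refine add_le_add ?_ ?_
  · calc ∫ y in K, mixingDensity β y ^ Fintype.card ι * tiltedProb y B
        ≤ ∫ y in K, δ * mixingDensity β y ^ Fintype.card ι := by
          refine setIntegral_mono_on hintB.integrableOn (hint.const_mul δ).integrableOn hK
            fun y hy => ?_
          rw [mul_comm]
          exact mul_le_mul_of_nonneg_right (h y hy) (hpos y)
      _ ≤ ∫ y, δ * mixingDensity β y ^ Fintype.card ι :=
          setIntegral_le_integral (hint.const_mul δ) (.of_forall fun y => mul_nonneg hδ (hpos y))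
      _ = _ := integral_const_mul _ _
  · exact setIntegral_mono_on hintB.integrableOn hint.integrableOn hK.compl fun y _ =>
      mul_le_of_le_one_right (hpos y) (tiltedProb_le_one y B)

end GaussianMixture

section HighTemperature

open scoped BigOperators

variable {ι : Type*} [Fintype ι]

-- Truncation at `L`: where the weight at `β` exceeds `L ^ k`, the weight at `l` exceeds it by a
-- factor `L`.
lemma curieWeissWeight_le_pow_add_div {β l L : ℝ} {k : ℕ} (hk : k ≠ 0)
    (hkl : β * (k + 1) ≤ l * k) (hL : 0 < L) (x : ι → ℤˣ) :
    curieWeissWeight β x ≤ L ^ k + curieWeissWeight l x / L := by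
  set u : ℝ := Real.exp (β / k / (2 * Fintype.card ι) * (∑ i, signVec x i) ^ 2)
  have hβ : curieWeissWeight β x = u ^ k := by
    rw [← Real.exp_nat_mul]
    simp only [curieWeissWeight, signVec]
    congr 1
    field_simp
  have hl : u ^ (k + 1) ≤ curieWeissWeight l x := by
    rw [← Real.exp_nat_mul]
    simp only [curieWeissWeight, signVec]
    rw [Real.exp_le_exp, ← mul_assoc, ← mul_div_assoc]
    gcongr
    push_cast
    rw [← mul_div_assoc, div_le_iff₀ (by positivity), mul_comm]
    exact hkl
  have hweight := curieWeissWeight_pos l x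
  rw [hβ]
  rcases le_total u L with h | h
  · exact (pow_le_pow_left₀ (Real.exp_pos _).le h k).trans (le_add_of_nonneg_right (by positivity))
  · refine le_add_of_nonneg_of_le (by positivity) ((le_div_iff₀ hL).2 (le_trans ?_ hl))
    rw [pow_succ]
    gcongr

lemma mixingDensity_pow_le (l : ℝ) (M : ℕ) (y : ℝ) :
    mixingDensity l y ^ M ≤ Real.exp (-(M / (2 * l) - M / 2) * y ^ 2) :=
  calc (Real.cosh y * Real.exp (-(y ^ 2 / (2 * l)))) ^ M
      ≤ (Real.exp (y ^ 2 / 2) * Real.exp (-(y ^ 2 / (2 * l)))) ^ M := by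
        have := Real.cosh_pos y
        gcongr
        exact Real.cosh_le_exp_half_sq y
    _ = _ := by
        rw [← Real.exp_add, ← Real.exp_nat_mul]
        congr 1
        ring

variable [DecidableEq ι]

lemma expect_curieWeissWeight_le [Nonempty ι] {l : ℝ} (hl0 : 0 < l) (hl1 : l < 1) :
    𝔼 x : ι → ℤˣ, curieWeissWeight l x ≤ √(1 / (1 - l)) := by
  have hl : 0 < 1 - l := sub_pos.2 hl1
  set b : ℝ := Fintype.card ι / (2 * l)
  have : 0 < b := by positivity
  have hvar : b - Fintype.card ι / 2 = b * (1 - l) := by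
    simp only [b]
    field_simp
  have hintegral : ∫ y, mixingDensity l y ^ Fintype.card ι ≤
      √(Real.pi / b) * √(1 / (1 - l)) := by
    rw [← Real.sqrt_mul (by positivity), div_mul_div_comm, mul_one, ← hvar, ← integral_gaussian]
    refine integral_mono (integrable_mixingDensity_pow hl0 Fintype.card_ne_zero)
      (integrable_exp_neg_mul_sq ?_) (mixingDensity_pow_le l _)
    rw [hvar]
    positivity
  rw [integral_mixingDensity_pow hl0, div_mul_eq_mul_div, mul_div_assoc] at hintegral
  rw [Fintype.expect_eq_sum_div_card, card_signs, Nat.cast_pow, Nat.cast_ofNat]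
  exact le_of_mul_le_mul_left hintegral (by positivity)

lemma curieWeissProb_le_pow_mul_dens_add [Nonempty ι] {β l L : ℝ} {k : ℕ} (hβ : 0 ≤ β)
    (hl0 : 0 < l) (hl1 : l < 1) (hk : k ≠ 0) (hkl : β * (k + 1) ≤ l * k) (hL : 0 < L)
    (B : Finset (ι → ℤˣ)) :
    curieWeissProb β B ≤ L ^ k * B.dens + √(1 / (1 - l)) / L := by
  have hexpect := expect_curieWeissWeight_le (ι := ι) hl0 hl1
  rw [Fintype.expect_eq_sum_div_card, card_signs, Nat.cast_pow, Nat.cast_ofNat,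
    div_le_iff₀' (by positivity)] at hexpect
  rw [curieWeissProb, inv_mul_le_iff₀ (curieWeissPartition_pos β)]
  calc ∑ x ∈ B, curieWeissWeight β x
      ≤ ∑ x ∈ B, (L ^ k + curieWeissWeight l x / L) :=
        Finset.sum_le_sum fun x _ => curieWeissWeight_le_pow_add_div hk hkl hL x
    _ = B.card * L ^ k + (∑ x ∈ B, curieWeissWeight l x) / L := by
        rw [Finset.sum_add_distrib, Finset.sum_const, nsmul_eq_mul, ← Finset.sum_div]
    _ ≤ B.card * L ^ k + 2 ^ Fintype.card ι * √(1 / (1 - l)) / L := by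
        gcongr
        exact (Finset.sum_le_univ_sum_of_nonneg fun x => (curieWeissWeight_pos l x).le).trans
          hexpect
    _ = 2 ^ Fintype.card ι * (L ^ k * B.dens + √(1 / (1 - l)) / L) := by
        rw [Finset.dens, card_signs]
        push_cast
        field_simp
    _ ≤ curieWeissPartition ι β * (L ^ k * B.dens + √(1 / (1 - l)) / L) := by
        gcongr
        exact two_pow_card_le_curieWeissPartition hβ

end HighTemperature

/-! ### Norm under the tilted product laws -/

section Symmetrization

open scoped Matrix.Norms.L2Operator

lemma norm_sub_sum_smul_pow_le {κ E : Type*} [Fintype κ] [NormedAddCommGroup E] [NormedSpace ℝ E]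
    {w : κ → ℝ} (hw : ∀ i, 0 ≤ w i) (hw1 : ∑ i, w i = 1) (a : E) (f : κ → E) (m : ℕ) :
    ‖a - ∑ i, w i • f i‖ ^ m ≤ ∑ i, w i * ‖a - f i‖ ^ m := by
  have hcenter : a - ∑ i, w i • f i = ∑ i, w i • (a - f i) := by
    simp only [smul_sub, Finset.sum_sub_distrib, ← Finset.sum_smul, hw1, one_smul]
  calc ‖a - ∑ i, w i • f i‖ ^ m ≤ (∑ i, w i * ‖a - f i‖) ^ m := by
        rw [hcenter]
        gcongr
        refine (norm_sum_le _ _).trans_eq (Finset.sum_congr rfl fun i _ => ?_)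
        rw [norm_smul, Real.norm_of_nonneg (hw i)]
    _ ≤ _ := Real.pow_arith_mean_le_arith_mean_pow _ _ _ (fun i _ => hw i) hw1
        (fun i _ => norm_nonneg _) m

lemma sum_tiltedSpinWeight_mul_sub_pow_of_odd (y : ℝ) {d : ℕ} (hd : Odd d) :
    ∑ s : ℤˣ, ∑ s' : ℤˣ, tiltedSpinWeight y s * tiltedSpinWeight y s' *
      ((((s : ℤ) : ℝ) - ((s' : ℤ) : ℝ)) / 2) ^ d = 0 := by
  refine self_eq_neg.1 (Finset.sum_comm.trans ?_)
  simp_rw [← Finset.sum_neg_distrib]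
  refine Finset.sum_congr rfl fun s _ => Finset.sum_congr rfl fun s' _ => ?_
  rw [← neg_sub ((s : ℤ) : ℝ), neg_div, hd.neg_pow]
  ring

lemma sum_tiltedSpinWeight_mul_sub_pow_nonneg (y : ℝ) {d : ℕ} (hd : Even d) :
    0 ≤ ∑ s : ℤˣ, ∑ s' : ℤˣ, tiltedSpinWeight y s * tiltedSpinWeight y s' *
      ((((s : ℤ) : ℝ) - ((s' : ℤ) : ℝ)) / 2) ^ d :=
  Finset.sum_nonneg fun s _ => Finset.sum_nonneg fun s' _ => mul_nonneg
    (mul_nonneg (tiltedSpinWeight_nonneg y s) (tiltedSpinWeight_nonneg y s')) (hd.pow_nonneg _)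

lemma sum_tiltedSpinWeight_mul_sub_pow_le_one (y : ℝ) (d : ℕ) :
    ∑ s : ℤˣ, ∑ s' : ℤˣ, tiltedSpinWeight y s * tiltedSpinWeight y s' *
      ((((s : ℤ) : ℝ) - ((s' : ℤ) : ℝ)) / 2) ^ d ≤ 1 := by
  have hdiff (s s' : ℤˣ) : |(((s : ℤ) : ℝ) - ((s' : ℤ) : ℝ)) / 2| ≤ 1 := by
    rcases Int.units_eq_one_or s with rfl | rfl <;> rcases Int.units_eq_one_or s' with rfl | rfl <;>
      norm_num
  calc _ ≤ ∑ s : ℤˣ, ∑ s' : ℤˣ, tiltedSpinWeight y s * tiltedSpinWeight y s' := by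
        refine Finset.sum_le_sum fun s _ => Finset.sum_le_sum fun s' _ => mul_le_of_le_one_right
          (mul_nonneg (tiltedSpinWeight_nonneg y s) (tiltedSpinWeight_nonneg y s')) ?_
        exact (le_abs_self _).trans
          ((abs_pow _ d).trans_le (pow_le_one₀ (abs_nonneg _) (hdiff s s')))
    _ = 1 := by rw [← Finset.sum_mul_sum, sum_tiltedSpinWeight, one_mul]

section Polynomial

open MvPolynomial

variable {σ : Type*} [Fintype σ] [DecidableEq σ]

lemma sum_tiltedWeight_mul_signVec (y : ℝ) (e : σ) :
    ∑ x : σ → ℤˣ, tiltedWeight y x * signVec x e = Real.tanh y := by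
  have hfactor (i : σ) :
      ∑ s : ℤˣ, tiltedSpinWeight y s * (if i = e then ((s : ℤ) : ℝ) else 1) =
        if i = e then Real.tanh y else 1 := by
    split_ifs
    · exact sum_tiltedSpinWeight_mul_self y
    · simp only [mul_one, sum_tiltedSpinWeight]
  simpa only [signVec, hfactor, Finset.prod_ite_eq', Finset.mem_univ, if_true] using
    sum_tiltedWeight_mul_prod y fun (i : σ) s => if i = e then ((s : ℤ) : ℝ) else 1

lemma sum_sum_tiltedWeight_mul_prod (y : ℝ) (f : σ → ℤˣ → ℤˣ → ℝ) :
    ∑ x : σ → ℤˣ, ∑ x' : σ → ℤˣ, tiltedWeight y x * tiltedWeight y x' * ∏ i, f i (x i) (x' i) =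
      ∏ i, ∑ s, ∑ s', tiltedSpinWeight y s * tiltedSpinWeight y s' * f i s s' := by
  simp_rw [mul_assoc, ← Finset.mul_sum]
  simp_rw [fun x : σ → ℤˣ => sum_tiltedWeight_mul_prod y fun i => f i (x i)]
  exact sum_tiltedWeight_mul_prod y fun i s => ∑ s', tiltedSpinWeight y s' * f i s s'

-- Half the difference of two independent copies of a tilted spin is a symmetric variable in
-- `{-1, 0, 1}`, so its moments are at most those of a random sign.
lemma sum_sum_tiltedWeight_mul_aeval_le_radMean (y : ℝ) (p : MvPolynomial σ ℕ) :
    ∑ x : σ → ℤˣ, ∑ x' : σ → ℤˣ, tiltedWeight y x * tiltedWeight y x' *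
      aeval (fun i => (signVec x i - signVec x' i) / 2) p ≤ radMean p := by
  induction p using MvPolynomial.induction_on' with
  | add p q hp hq =>
    simp only [map_add, mul_add, Finset.sum_add_distrib]
    exact add_le_add hp hq
  | monomial d c =>
    simp_rw [aeval_monomial, eq_natCast, Finsupp.prod_fintype _ _ fun _ => pow_zero _,
      mul_left_comm _ (c : ℝ), ← Finset.mul_sum]
    rw [radMean_monomial]
    refine mul_le_mul_of_nonneg_left ?_ c.cast_nonneg
    refine (sum_sum_tiltedWeight_mul_prod y fun i s s' =>
      ((((s : ℤ) : ℝ) - ((s' : ℤ) : ℝ)) / 2) ^ d i).trans_le ?_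
    split_ifs with h
    · exact Finset.prod_le_one
        (fun i _ => sum_tiltedSpinWeight_mul_sub_pow_nonneg y (h i))
        fun i _ => sum_tiltedSpinWeight_mul_sub_pow_le_one y (d i)
    · obtain ⟨i, hi⟩ := not_forall.1 h
      exact (Finset.prod_eq_zero (Finset.mem_univ i)
        (sum_tiltedSpinWeight_mul_sub_pow_of_odd y (Nat.not_even_iff_odd.1 hi))).le

end Polynomial

variable {n : Type*} [Fintype n] [LinearOrder n]

lemma sum_tiltedWeight_smul_signMatrix (y : ℝ) :
    ∑ x : n × n → ℤˣ, tiltedWeight y x • signMatrix x =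
      Real.tanh y • Matrix.of fun _ _ => 1 := by
  ext i j
  simp only [Matrix.sum_apply, Matrix.smul_apply, Matrix.of_apply, smul_eq_mul, mul_one]
  exact sum_tiltedWeight_mul_signVec y (upperIndex i j)

lemma norm_signMatrix_sub_pow_le_trace [Nonempty n] (x x' : n × n → ℤˣ) (k : ℕ) :
    ‖signMatrix x - signMatrix x'‖ ^ (2 * k) ≤
      4 ^ k * ((symmMatrix fun e => (signVec x e - signVec x' e) / 2) ^ (2 * k)).trace := by
  have hdiff : signMatrix x - signMatrix x' =
      (2 : ℝ) • symmMatrix fun e => (signVec x e - signVec x' e) / 2 := by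
    ext i j
    simp only [signMatrix, Matrix.sub_apply, Matrix.smul_apply, symmMatrix_apply, smul_eq_mul]
    ring
  rw [hdiff, norm_smul, mul_pow, pow_mul ‖(2 : ℝ)‖, Real.norm_two, show (2 : ℝ) ^ 2 = 4 by norm_num]
  exact mul_le_mul_of_nonneg_left (norm_pow_le_trace (isSymm_symmMatrix _) k) (by positivity)

lemma sum_tiltedWeight_mul_norm_pow_le [Nonempty n] (y : ℝ) (k : ℕ) :
    ∑ x : n × n → ℤˣ, tiltedWeight y x *
      ‖signMatrix x - Real.tanh y • (Matrix.of fun _ _ => 1)‖ ^ (2 * k) ≤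
      4 ^ k * traceMoment n (2 * k) := by
  simp_rw [← sum_tiltedWeight_smul_signMatrix]
  calc _ ≤ ∑ x : n × n → ℤˣ, tiltedWeight y x * ∑ x' : n × n → ℤˣ, tiltedWeight y x' *
        (4 ^ k * ((symmMatrix fun e => (signVec x e - signVec x' e) / 2) ^ (2 * k)).trace) :=
        Finset.sum_le_sum fun x _ => mul_le_mul_of_nonneg_left
          ((norm_sub_sum_smul_pow_le (tiltedWeight_nonneg y) (sum_tiltedWeight y) _ _ _).trans
            (Finset.sum_le_sum fun x' _ => mul_le_mul_of_nonneg_left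
              (norm_signMatrix_sub_pow_le_trace x x' k) (tiltedWeight_nonneg y x')))
          (tiltedWeight_nonneg y x)
    _ = 4 ^ k * ∑ x : n × n → ℤˣ, ∑ x' : n × n → ℤˣ, tiltedWeight y x * tiltedWeight y x' *
        MvPolynomial.aeval (fun e => (signVec x e - signVec x' e) / 2)
          (genericSymm n ^ (2 * k)).trace := by
        simp_rw [aeval_trace_genericSymm_pow, Finset.mul_sum]
        exact Finset.sum_congr rfl fun x _ => Finset.sum_congr rfl fun x' _ => by ring
    _ ≤ _ := mul_le_mul_of_nonneg_left (sum_sum_tiltedWeight_mul_aeval_le_radMean y _)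
        (by positivity)

lemma tiltedProb_mul_pow_le [Nonempty n] {y s : ℝ} (hs : 0 ≤ s) {B : Finset (n × n → ℤˣ)}
    (hB : ∀ x ∈ B, s ≤ ‖signMatrix x - Real.tanh y • (Matrix.of fun _ _ => 1)‖) (k : ℕ) :
    tiltedProb y B * s ^ (2 * k) ≤ 4 ^ k * traceMoment n (2 * k) := by
  refine le_trans ?_ (sum_tiltedWeight_mul_norm_pow_le y k)
  rw [tiltedProb, Finset.sum_mul]
  refine (Finset.sum_le_sum fun x hx => ?_).trans (Finset.sum_le_univ_sum_of_nonneg fun x =>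
    mul_nonneg (tiltedWeight_nonneg y x) (by positivity))
  exact mul_le_mul_of_nonneg_left (pow_le_pow_left₀ hs (hB x hx) _) (tiltedWeight_nonneg y x)

lemma traceMoment_two_mul_le_const_mul_pow [Nonempty n] (k : ℕ) :
    traceMoment n (2 * k) ≤
      (1 + (2 * k + 4 * k ^ 3)) ^ k * 4 ^ k * (Fintype.card n : ℝ) ^ (k + 1) := by
  have hn : (1 : ℝ) ≤ Fintype.card n := Nat.one_le_cast.2 Fintype.card_pos
  have h₁ : (2 * k / Fintype.card n : ℝ) ≤ 2 * k := div_le_self (by positivity) hn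
  have h₂ : (4 * k ^ 3 / Fintype.card n ^ 2 : ℝ) ≤ 4 * k ^ 3 :=
    div_le_self (by positivity) (one_le_pow₀ hn)
  calc _ ≤ _ := traceMoment_two_mul_le le_rfl
    _ ≤ (Fintype.card n : ℝ) ^ (k + 1) * (1 + (2 * k + 4 * k ^ 3)) ^ k * 4 ^ k := by
        gcongr
        exact_mod_cast catalan_le_four_pow k
    _ = _ := by ring

omit [LinearOrder n] in
lemma abs_norm_sub_abs_mul_card_le [DecidableEq n] (A : Matrix n n ℝ) (t : ℝ) :
    |‖A‖ - |t| * Fintype.card n| ≤ ‖A - t • (Matrix.of fun _ _ => 1)‖ := by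
  have h := abs_norm_sub_norm_le A (t • (Matrix.of fun _ _ => 1))
  rwa [norm_smul, norm_all_ones, Real.norm_eq_abs] at h

end Symmetrization

/-! ### Concentration of the mixing density -/

section Tanh

lemma hasDerivAt_tanh (y : ℝ) : HasDerivAt Real.tanh (1 / Real.cosh y ^ 2) y := by
  rw [funext Real.tanh_eq_sinh_div_cosh]
  refine ((Real.hasDerivAt_sinh y).div (Real.hasDerivAt_cosh y)
    (Real.cosh_pos y).ne').congr_deriv ?_
  rw [← sq, ← sq, Real.cosh_sq y, add_sub_cancel_left]

lemma lipschitzWith_tanh : LipschitzWith 1 Real.tanh := by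
  refine lipschitzWith_of_nnnorm_deriv_le (fun y => (hasDerivAt_tanh y).differentiableAt)
    fun y => ?_
  rw [(hasDerivAt_tanh y).deriv, ← NNReal.coe_le_coe, coe_nnnorm, NNReal.coe_one,
    Real.norm_of_nonneg (by positivity)]
  exact div_le_one_of_le₀ (one_le_pow₀ (Real.one_le_cosh y)) (by positivity)

lemma abs_tanh_sub_tanh_le (a b : ℝ) : |Real.tanh a - Real.tanh b| ≤ |a - b| := by
  simpa only [Real.dist_eq, NNReal.coe_one, one_mul] using lipschitzWith_tanh.dist_le_mul a b

lemma abs_tanh_le_abs (y : ℝ) : |Real.tanh y| ≤ |y| := by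
  simpa only [Real.tanh_zero, sub_zero] using abs_tanh_sub_tanh_le y 0

lemma abs_tanh (y : ℝ) : |Real.tanh y| = Real.tanh |y| := by
  rw [Real.tanh_eq_sinh_div_cosh, abs_div, Real.abs_sinh, Real.tanh_eq_sinh_div_cosh, Real.cosh_abs,
    abs_of_pos (Real.cosh_pos y)]

lemma strictConcaveOn_tanh : StrictConcaveOn ℝ (Set.Ici 0) Real.tanh := by
  refine StrictAntiOn.strictConcaveOn_of_deriv (convex_Ici 0)
    lipschitzWith_tanh.continuous.continuousOn ?_
  rw [interior_Ici]
  intro a ha b hb hab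
  rw [(hasDerivAt_tanh a).deriv, (hasDerivAt_tanh b).deriv]
  have := Real.cosh_pos a
  have := Real.cosh_strictMonoOn (Set.Ioi_subset_Ici_self ha) (Set.Ioi_subset_Ici_self hb) hab
  gcongr

lemma strictAntiOn_tanh_div : StrictAntiOn (fun y => Real.tanh y / y) (Set.Ioi 0) := by
  intro a ha b _ hab
  simpa only [Real.tanh_zero, sub_zero] using strictConcaveOn_tanh.secant_strict_mono
    Set.self_mem_Ici (Set.Ioi_subset_Ici_self ha) (Set.mem_Ici.2 (ha.trans hab).le) (ne_of_gt ha)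
    (ha.trans hab).ne' hab

lemma exists_tanh_eq_div {β : ℝ} (hβ : 1 < β) : ∃ y, 0 < y ∧ Real.tanh y = y / β := by
  have hβ0 : 0 < β := one_pos.trans hβ
  have hslope : Tendsto (fun t => t⁻¹ * Real.tanh t) (𝓝[>] 0) (𝓝 1) := by
    simpa only [zero_add, Real.tanh_zero, sub_zero, Real.cosh_zero, one_pow, div_one,
      smul_eq_mul] using (hasDerivAt_tanh 0).tendsto_slope_zero_right
  obtain ⟨a, haβ, ha0, ha⟩ := ((hslope.eventually_const_lt (inv_lt_one_of_one_lt₀ hβ)).and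
    (Ioo_mem_nhdsGT hβ0)).exists
  have hcont : ContinuousOn (fun y => Real.tanh y - y / β) (Set.Icc a β) :=
    (lipschitzWith_tanh.continuous.sub (continuous_id.div_const β)).continuousOn
  have hmem : (0 : ℝ) ∈ Set.Icc (Real.tanh β - β / β) (Real.tanh a - a / β) := by
    constructor
    · rw [div_self hβ0.ne']
      exact (sub_neg.2 (Real.tanh_lt_one β)).le
    · rw [sub_nonneg, div_eq_mul_inv]
      exact ((lt_inv_mul_iff₀ ha0).1 haβ).le
  obtain ⟨y, hy, hy0⟩ := intermediate_value_Icc' ha.le hcont hmem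
  exact ⟨y, ha0.trans_le hy.1, sub_eq_zero.1 hy0⟩

end Tanh

section MixingDensity

variable {β : ℝ}

lemma mixingDensity_abs (β y : ℝ) : mixingDensity β |y| = mixingDensity β y := by
  rw [mixingDensity, mixingDensity, Real.cosh_abs, sq_abs]

lemma hasDerivAt_mixingDensity (β y : ℝ) :
    HasDerivAt (mixingDensity β) (mixingDensity β y * (Real.tanh y - y / β)) y := by
  have hexponent : HasDerivAt (fun y : ℝ => -(y ^ 2 / (2 * β))) (-(y / β)) y := by
    refine ((hasDerivAt_pow 2 y).div_const (2 * β)).neg.congr_deriv ?_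
    push_cast
    ring
  refine ((Real.hasDerivAt_cosh y).mul hexponent.exp).congr_deriv ?_
  rw [mixingDensity, Real.tanh_eq_sinh_div_cosh]
  have := (Real.cosh_pos y).ne'
  field_simp
  ring

lemma setIntegral_compl_mixingDensity_pow_le (hβ : 0 < β) {K : Set ℝ} (hK : MeasurableSet K)
    {c : ℝ} (hc0 : 0 ≤ c) (hc : ∀ y ∉ K, mixingDensity β y ≤ c) (M : ℕ) :
    ∫ y in Kᶜ, mixingDensity β y ^ (M + 1) ≤ c ^ M * ∫ y, mixingDensity β y := by
  have hint : Integrable (mixingDensity β) := by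
    simpa only [pow_one] using integrable_mixingDensity_pow hβ one_ne_zero
  have hpos := mixingDensity_pos β
  calc ∫ y in Kᶜ, mixingDensity β y ^ (M + 1) ≤ ∫ y in Kᶜ, c ^ M * mixingDensity β y := by
        refine setIntegral_mono_on (integrable_mixingDensity_pow hβ M.succ_ne_zero).integrableOn
          (hint.const_mul _).integrableOn hK.compl fun y hy => ?_
        rw [pow_succ]
        exact mul_le_mul_of_nonneg_right (pow_le_pow_left₀ (hpos y).le (hc y hy) M) (hpos y).le
    _ ≤ ∫ y, c ^ M * mixingDensity β y := setIntegral_le_integral (hint.const_mul _)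
        (Eventually.of_forall fun y => mul_nonneg (pow_nonneg hc0 M) (hpos y).le)
    _ = _ := integral_const_mul _ _

lemma exists_mul_pow_le_integral_mixingDensity_pow (hβ : 0 < β) {y₀ d : ℝ} (hd : 0 ≤ d)
    (hdy : d < mixingDensity β y₀) :
    ∃ r > 0, ∀ M : ℕ, M ≠ 0 → r * d ^ M ≤ ∫ y, mixingDensity β y ^ M := by
  obtain ⟨r, hr, hball⟩ := Metric.mem_nhds_iff.1
    ((continuous_mixingDensity β).continuousAt.eventually_const_lt hdy)
  refine ⟨2 * r, by positivity, fun M hM => ?_⟩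
  have hint := integrable_mixingDensity_pow hβ hM
  calc 2 * r * d ^ M = ∫ _ in Metric.ball y₀ r, d ^ M := by
        rw [setIntegral_const, Real.volume_real_ball hr.le, smul_eq_mul]
    _ ≤ ∫ y in Metric.ball y₀ r, mixingDensity β y ^ M :=
        setIntegral_mono_on (integrableOn_const measure_ball_lt_top.ne) hint.integrableOn
          measurableSet_ball fun y hy => pow_le_pow_left₀ hd (le_of_lt (hball hy)) M
    _ ≤ _ := setIntegral_le_integral hint
        (Eventually.of_forall fun y => pow_nonneg (mixingDensity_pos β y).le M)

section LowTemperature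

variable {y₀ : ℝ}

lemma strictMonoOn_mixingDensity (hy : Real.tanh y₀ = y₀ / β) :
    StrictMonoOn (mixingDensity β) (Set.Icc 0 y₀) := by
  refine strictMonoOn_of_deriv_pos (convex_Icc 0 y₀) (continuous_mixingDensity β).continuousOn
    fun y h => ?_
  rw [interior_Icc] at h
  have hy0 : 0 < y₀ := h.1.trans h.2
  rw [(hasDerivAt_mixingDensity β y).deriv]
  have hdiv : Real.tanh y₀ / y₀ < Real.tanh y / y := strictAntiOn_tanh_div h.1 hy0 h.2
  rw [hy, div_div_cancel_left' hy0.ne', lt_div_iff₀ h.1, inv_mul_eq_div] at hdiv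
  exact mul_pos (mixingDensity_pos β y) (sub_pos.2 hdiv)

lemma strictAntiOn_mixingDensity (hy0 : 0 < y₀) (hy : Real.tanh y₀ = y₀ / β) :
    StrictAntiOn (mixingDensity β) (Set.Ici y₀) := by
  refine strictAntiOn_of_deriv_neg (convex_Ici y₀) (continuous_mixingDensity β).continuousOn
    fun y h => ?_
  rw [interior_Ici] at h
  have hpos : 0 < y := hy0.trans h
  rw [(hasDerivAt_mixingDensity β y).deriv]
  have hdiv : Real.tanh y / y < Real.tanh y₀ / y₀ := strictAntiOn_tanh_div hy0 hpos h
  rw [hy, div_div_cancel_left' hy0.ne', div_lt_iff₀ hpos, inv_mul_eq_div] at hdiv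
  exact mul_neg_of_pos_of_neg (mixingDensity_pos β y) (sub_neg.2 hdiv)

lemma exists_mixingDensity_le_of_lt_abs (hy0 : 0 < y₀) (hy : Real.tanh y₀ = y₀ / β) {δ : ℝ}
    (hδ : 0 < δ) :
    ∃ c > 0, c < mixingDensity β y₀ ∧ ∀ y, δ < |(|y|) - y₀| → mixingDensity β y ≤ c := by
  have hmono := strictMonoOn_mixingDensity hy
  have hanti := strictAntiOn_mixingDensity hy0 hy
  obtain ⟨η, hη0, hη⟩ := exists_between (lt_min hδ hy0)
  obtain ⟨hηδ, hηy⟩ := lt_min_iff.1 hη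
  have hleft : y₀ - η ∈ Set.Icc 0 y₀ := ⟨by linarith, by linarith⟩
  have hright : y₀ + η ∈ Set.Ici y₀ := Set.mem_Ici.2 (by linarith)
  refine ⟨max (mixingDensity β (y₀ - η)) (mixingDensity β (y₀ + η)),
    lt_max_of_lt_left (mixingDensity_pos _ _), max_lt ?_ ?_, fun y h => ?_⟩
  · exact hmono hleft (Set.right_mem_Icc.2 hy0.le) (by linarith)
  · exact hanti Set.self_mem_Ici hright (by linarith)
  · rw [← mixingDensity_abs]
    rcases lt_abs.1 (hηδ.trans h) with h | h
    · exact le_max_of_le_right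
        (hanti.antitoneOn hright (Set.mem_Ici.2 (by linarith)) (by linarith))
    · exact le_max_of_le_left
        (hmono.monotoneOn ⟨abs_nonneg y, by linarith⟩ hleft (by linarith))

lemma measurableSet_abs_abs_sub_le (y₀ δ : ℝ) : MeasurableSet {y : ℝ | |(|y|) - y₀| ≤ δ} :=
  (isClosed_le (by fun_prop) continuous_const).measurableSet

-- Laplace's method: the `M`-th power of the density concentrates where it is maximal.
lemma exists_setIntegral_mixingDensity_pow_div_le (hβ : 0 < β) (hy0 : 0 < y₀)
    (hy : Real.tanh y₀ = y₀ / β) {δ : ℝ} (hδ : 0 < δ) :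
    ∃ C ρ : ℝ, 0 ≤ ρ ∧ ρ < 1 ∧ ∀ M : ℕ, M ≠ 0 →
      (∫ y in {y | |(|y|) - y₀| ≤ δ}ᶜ, mixingDensity β y ^ M) / ∫ y, mixingDensity β y ^ M ≤
        C * ρ ^ M := by
  obtain ⟨c, hc0, hcy, hc⟩ := exists_mixingDensity_le_of_lt_abs hy0 hy hδ
  obtain ⟨d, hcd, hdy⟩ := exists_between hcy
  have hd0 : 0 < d := hc0.trans hcd
  obtain ⟨r, hr, hlow⟩ := exists_mul_pow_le_integral_mixingDensity_pow hβ hd0.le hdy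
  have hI : 0 ≤ ∫ y, mixingDensity β y := integral_nonneg fun y => (mixingDensity_pos β y).le
  refine ⟨(∫ y, mixingDensity β y) / (r * c), c / d, by positivity, (div_lt_one hd0).2 hcd,
    fun M hM => ?_⟩
  obtain ⟨M, rfl⟩ := Nat.exists_eq_succ_of_ne_zero hM
  calc _ ≤ (c ^ M * ∫ y, mixingDensity β y) / (r * d ^ (M + 1)) :=
        div_le_div₀ (by positivity) (setIntegral_compl_mixingDensity_pow_le hβ
            (measurableSet_abs_abs_sub_le y₀ δ) hc0.le (fun y h => hc y (not_le.1 h)) M)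
          (by positivity) (hlow _ hM)
    _ = _ := by
      rw [Nat.succ_eq_add_one, div_pow, pow_succ c]
      field_simp

end LowTemperature

section CriticalTemperature

lemma antitoneOn_mixingDensity_one : AntitoneOn (mixingDensity 1) (Set.Ici 0) := by
  refine antitoneOn_of_deriv_nonpos (convex_Ici 0) (continuous_mixingDensity 1).continuousOn
    (fun y _ => (hasDerivAt_mixingDensity 1 y).differentiableAt.differentiableWithinAt)
    fun y h => ?_
  rw [interior_Ici] at h
  have htanh : Real.tanh y ≤ y :=
    (le_abs_self _).trans ((abs_tanh_le_abs y).trans_eq (abs_of_pos h))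
  rw [(hasDerivAt_mixingDensity 1 y).deriv, div_one]
  exact mul_nonpos_of_nonneg_of_nonpos (mixingDensity_pos 1 y).le (sub_nonpos.2 htanh)

lemma cosh_le_of_abs_le_one {r : ℝ} (hr : |r| ≤ 1) :
    Real.cosh r ≤ 1 + r ^ 2 / 2 + r ^ 4 / 24 + |r| ^ 6 * (7 / 4320) := by
  have h₁ := (abs_le.1 (Real.exp_bound hr (n := 6) (by norm_num))).2
  have h₂ := (abs_le.1 (Real.exp_bound ((abs_neg r).trans_le hr) (n := 6) (by norm_num))).2
  simp only [Finset.sum_range_succ, Finset.sum_range_zero, Nat.factorial, abs_neg] at h₁ h₂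
  norm_num at h₁ h₂
  rw [Real.cosh_eq]
  linarith

lemma mixingDensity_one_le {r : ℝ} (h0 : 0 ≤ r) (h1 : r ≤ 1) :
    mixingDensity 1 r ≤ Real.exp (-(r ^ 4 / 24)) := by
  have hr2 : r ^ 2 ≤ 1 := pow_le_one₀ h0 h1
  have hcosh : Real.cosh r ≤ Real.exp (r ^ 2 / 2 - r ^ 4 / 24) := by
    have hr6 : r ^ 6 ≤ r ^ 4 := pow_le_pow_of_le_one h0 h1 (by norm_num)
    have : 0 ≤ r ^ 4 := by positivity
    have : 0 ≤ r ^ 8 := by positivity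
    calc Real.cosh r ≤ 1 + r ^ 2 / 2 + r ^ 4 / 24 + r ^ 6 * (7 / 4320) := by
          simpa only [abs_of_nonneg h0] using
            cosh_le_of_abs_le_one ((abs_of_nonneg h0).trans_le h1)
      _ ≤ 1 + (r ^ 2 / 2 - r ^ 4 / 24) + (r ^ 2 / 2 - r ^ 4 / 24) ^ 2 / 2 := by nlinarith
      _ ≤ _ := Real.quadratic_le_exp_of_nonneg (by nlinarith [sq_nonneg r])
  calc mixingDensity 1 r
      ≤ Real.exp (r ^ 2 / 2 - r ^ 4 / 24) * Real.exp (-(r ^ 2 / (2 * 1))) :=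
        mul_le_mul_of_nonneg_right hcosh (Real.exp_pos _).le
    _ = _ := by
      rw [← Real.exp_add]
      congr 1
      ring

lemma inv_le_integral_mixingDensity_one_pow {M : ℕ} (hM : M ≠ 0) :
    (M : ℝ)⁻¹ ≤ ∫ y, mixingDensity 1 y ^ M := by
  have hM1 : (1 : ℝ) ≤ M := Nat.one_le_cast.2 (Nat.one_le_iff_ne_zero.2 hM)
  have hle (y : ℝ) : Real.exp (-(M / 2) * y ^ 2) ≤ mixingDensity 1 y ^ M := by
    calc Real.exp (-(M / 2) * y ^ 2) = Real.exp (-(y ^ 2 / (2 * 1))) ^ M := by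
          rw [← Real.exp_nat_mul]
          congr 1
          ring
      _ ≤ _ := pow_le_pow_left₀ (Real.exp_pos _).le
          (le_mul_of_one_le_left (Real.exp_pos _).le (Real.one_le_cosh y)) M
  calc (M : ℝ)⁻¹ ≤ √(Real.pi / (M / 2)) := by
        refine Real.le_sqrt_of_sq_le ?_
        rw [inv_pow, ← one_div, div_le_div_iff₀ (by positivity) (by positivity)]
        nlinarith [Real.pi_gt_three]
    _ = ∫ y, Real.exp (-(M / 2) * y ^ 2) := (integral_gaussian _).symm
    _ ≤ _ := integral_mono (integrable_exp_neg_mul_sq (by positivity))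
        (integrable_mixingDensity_pow one_pos hM) hle

lemma measurableSet_abs_le (r : ℝ) : MeasurableSet {y : ℝ | |y| ≤ r} :=
  (isClosed_le continuous_abs continuous_const).measurableSet

-- At `β = 1` the density is quartic at its maximum `0`, so its `M`-th power lives on the scale
-- `M ^ (-1/4)`.
lemma exists_setIntegral_mixingDensity_one_pow_div_le :
    ∃ C : ℝ, ∀ (M : ℕ) (r : ℝ), M ≠ 0 → 0 ≤ r → r ≤ 1 →
      (∫ y in {y | |y| ≤ r}ᶜ, mixingDensity 1 y ^ M) / ∫ y, mixingDensity 1 y ^ M ≤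
        C * (M * Real.exp (-(M * r ^ 4 / 24))) := by
  have hI : 0 ≤ ∫ y, mixingDensity 1 y := integral_nonneg fun y => (mixingDensity_pos 1 y).le
  refine ⟨Real.exp 1 * ∫ y, mixingDensity 1 y, fun M r hM hr0 hr1 => ?_⟩
  obtain ⟨M, rfl⟩ := Nat.exists_eq_succ_of_ne_zero hM
  have hout (y : ℝ) (hy : y ∉ {y : ℝ | |y| ≤ r}) :
      mixingDensity 1 y ≤ Real.exp (-(r ^ 4 / 24)) := by
    rw [← mixingDensity_abs]
    exact (antitoneOn_mixingDensity_one hr0 (abs_nonneg y) (not_le.1 hy).le).trans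
      (mixingDensity_one_le hr0 hr1)
  have hexp : Real.exp (-(r ^ 4 / 24)) ^ M ≤
      Real.exp 1 * Real.exp (-((M + 1 : ℕ) * r ^ 4 / 24)) := by
    rw [← Real.exp_nat_mul, ← Real.exp_add, Real.exp_le_exp]
    have : r ^ 4 ≤ 1 := pow_le_one₀ hr0 hr1
    push_cast
    linarith
  calc _ ≤ (Real.exp 1 * Real.exp (-((M + 1 : ℕ) * r ^ 4 / 24)) * ∫ y, mixingDensity 1 y) /
        ((M + 1 : ℕ) : ℝ)⁻¹ :=
        div_le_div₀ (by positivity) ((setIntegral_compl_mixingDensity_pow_le one_pos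
            (measurableSet_abs_le r) (Real.exp_pos _).le hout M).trans
            (mul_le_mul_of_nonneg_right hexp hI))
          (by positivity) (inv_le_integral_mixingDensity_one_pow hM)
    _ = _ := by
      rw [div_inv_eq_mul]
      ring

end CriticalTemperature

end MixingDensity

/-! ### Almost sure convergence -/

section AlmostSureConvergence

open Asymptotics
open scoped Matrix.Norms.L2Operator

lemma summable_of_superpolynomialDecay {u : ℕ → ℝ}
    (hu : SuperpolynomialDecay atTop (fun N : ℕ => (N : ℝ)) u) : Summable u := by
  refine summable_of_isBigO_nat (Real.summable_nat_pow_inv.2 one_lt_two) ?_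
  exact ((superpolynomialDecay_iff_isBigO u tendsto_natCast_atTop_atTop).1 hu (-2)).congr_right
    fun N => zpow_neg _ _

variable {Ω : Type*} [MeasurableSpace Ω] {P : Measure Ω} [IsProbabilityMeasure P] {β : ℝ}
  {X : (N : ℕ) → Ω → Matrix (Fin N) (Fin N) ℝ}

namespace IsFullCurieWeissEnsemble

lemma measure_le (hX : IsFullCurieWeissEnsemble P β X) {N : ℕ}
    {S : Set (Matrix (Fin N) (Fin N) ℝ)} {B : Finset (Fin N × Fin N → ℤˣ)}
    (hB : ∀ x, signMatrix x ∈ S → x ∈ B) :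
    P {ω | X N ω ∈ S} ≤ ENNReal.ofReal (curieWeissProb β B) := by
  obtain ⟨Y, hY, hXY⟩ := hX N
  have hsymm (ω : Ω) : X N ω = symmMatrix fun e => Y e ω := by
    ext i j
    rw [hXY, symmMatrix_apply, upperIndex]
    split_ifs with h
    · rw [min_eq_left h, max_eq_right h]
    · rw [min_eq_right (le_of_not_ge h), max_eq_left (le_of_not_ge h)]
  simp_rw [hsymm]
  exact hY.measure_le (S := symmMatrix ⁻¹' S) hB

lemma ae_eventually_notMem (hX : IsFullCurieWeissEnsemble P β X)
    {S : (N : ℕ) → Set (Matrix (Fin N) (Fin N) ℝ)} {B : (N : ℕ) → Finset (Fin N × Fin N → ℤˣ)}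
    (hB : ∀ N x, signMatrix x ∈ S N → x ∈ B N)
    (hsum : Summable fun N => curieWeissProb β (B N)) :
    ∀ᵐ ω ∂P, ∀ᶠ N in atTop, X N ω ∉ S N :=
  MeasureTheory.ae_eventually_notMem (s := fun N => {ω | X N ω ∈ S N}) <|
    ne_top_of_le_ne_top hsum.tsum_ofReal_ne_top <|
      ENNReal.tsum_le_tsum fun N => hX.measure_le (hB N)

end IsFullCurieWeissEnsemble

/-- The configurations for which `c` times the norm of the sign matrix differs from `a` by at
least `ε`. -/
def farNormConfigs (n : Type*) [Fintype n] [LinearOrder n] (c a ε : ℝ) :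
    Finset (n × n → ℤˣ) :=
  open Classical in {x | ε ≤ |c * ‖signMatrix x‖ - a|}

lemma mem_farNormConfigs {n : Type*} [Fintype n] [LinearOrder n] {c a ε : ℝ} {x : n × n → ℤˣ} :
    x ∈ farNormConfigs n c a ε ↔ ε ≤ |c * ‖signMatrix x‖ - a| := by
  simp [farNormConfigs]

lemma IsFullCurieWeissEnsemble.ae_tendsto_norm (hX : IsFullCurieWeissEnsemble P β X) {c : ℕ → ℝ}
    (hc : ∀ N, 0 ≤ c N) {a : ℝ}
    (hsum : ∀ ε > 0, Summable fun N => curieWeissProb β (farNormConfigs (Fin N) (c N) a ε)) :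
    ∀ᵐ ω ∂P, Tendsto (fun N => euclideanOpNorm (c N • X N ω)) atTop (𝓝 a) := by
  have hfar (j : ℕ) : ∀ᵐ ω ∂P, ∀ᶠ N in atTop,
      X N ω ∉ {A | 1 / ((j : ℝ) + 1) ≤ |c N * ‖A‖ - a|} :=
    hX.ae_eventually_notMem (fun N x hx => mem_farNormConfigs.2 hx) (hsum _ (by positivity))
  filter_upwards [ae_all_iff.2 hfar] with ω hω
  refine Metric.nhds_basis_ball_inv_nat_succ.tendsto_right_iff.2 fun j _ => ?_
  filter_upwards [hω j] with N hN
  rw [mem_ball_iff_norm, euclideanOpNorm_eq_norm, norm_smul, Real.norm_of_nonneg (hc N)]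
  exact not_le.1 hN

end AlmostSureConvergence

section HighTemperature

open Asymptotics
open scoped Matrix.Norms.L2Operator

lemma superpolynomialDecay_dens_farNormConfigs {ε : ℝ} (hε : 0 < ε) :
    SuperpolynomialDecay atTop (fun N : ℕ => (N : ℝ))
      fun N => ((farNormConfigs (Fin N) (1 / √N) 2 ε).dens : ℝ) := by
  have hlarge := superpolynomialDecay_dens_largeNormConfigs (lt_add_of_pos_right 2 hε)
  have hsmall := superpolynomialDecay_dens_smallNormConfigs (le_max_right (2 - ε) 0)
    (max_lt (sub_lt_self 2 hε) two_pos)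
  refine SuperpolynomialDecay.trans_eventuallyLE (.of_forall fun N => N.cast_nonneg)
    (superpolynomialDecay_zero _ _) (hlarge.add hsmall)
    (.of_forall fun N => NNRat.cast_nonneg _) ?_
  filter_upwards [eventually_gt_atTop 0] with N hN
  have hsqrt : 0 < √(N : ℝ) := Real.sqrt_pos.2 (Nat.cast_pos.2 hN)
  have hsub : farNormConfigs (Fin N) (1 / √N) 2 ε ⊆
      largeNormConfigs (Fin N) ((2 + ε) * √N) ∪ smallNormConfigs (Fin N) (max (2 - ε) 0 * √N) := by
    intro x hx
    rw [mem_farNormConfigs, one_div_mul_eq_div, le_abs] at hx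
    rw [Finset.mem_union, mem_largeNormConfigs, mem_smallNormConfigs, ← le_div_iff₀ hsqrt,
      ← div_le_iff₀ hsqrt]
    exact hx.imp (fun h => by linarith) fun h => le_max_of_le_left (by linarith)
  rw [Pi.add_apply]
  exact_mod_cast (Finset.dens_le_dens hsub).trans (Finset.dens_union_le _ _)

lemma summable_curieWeissProb_of_superpolynomialDecay {β : ℝ} (hβ0 : 0 ≤ β) (hβ1 : β < 1)
    {B : (N : ℕ) → Finset (Fin N × Fin N → ℤˣ)}
    (hB : SuperpolynomialDecay atTop (fun N : ℕ => (N : ℝ)) fun N => ((B N).dens : ℝ)) :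
    Summable fun N => curieWeissProb β (B N) := by
  obtain ⟨l, hβl, hl1⟩ := exists_between hβ1
  obtain ⟨k, hk⟩ := exists_nat_gt (β / (l - β))
  have hk0 : (0 : ℝ) < k := (div_nonneg hβ0 (sub_nonneg.2 hβl.le)).trans_lt hk
  have hkl : β * (k + 1) ≤ l * k := by
    rw [div_lt_iff₀ (sub_pos.2 hβl)] at hk
    linarith
  refine .of_norm_bounded_eventually_nat
    ((summable_of_superpolynomialDecay (hB.param_pow_mul (2 * k))).add
      ((Real.summable_nat_pow_inv.2 one_lt_two).mul_left √(1 / (1 - l)))) ?_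
  filter_upwards [eventually_gt_atTop 0] with N hN
  have : NeZero N := ⟨hN.ne'⟩
  rw [Real.norm_of_nonneg (curieWeissProb_nonneg _ _)]
  refine (curieWeissProb_le_pow_mul_dens_add hβ0 (hβ0.trans_lt hβl) hl1
    (Nat.cast_pos.1 hk0).ne' hkl (by positivity : (0 : ℝ) < N ^ 2) (B N)).trans_eq ?_
  rw [← pow_mul, div_eq_mul_inv _ ((N : ℝ) ^ 2)]
  rfl

end HighTemperature

section GaussianMixtureSummability

open scoped Matrix.Norms.L2Operator

lemma summable_curieWeissProb_of_tiltedProb_le {β : ℝ} (hβ : 0 < β)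
    {B : (N : ℕ) → Finset (Fin N × Fin N → ℤˣ)} {K : ℕ → Set ℝ} {u v : ℕ → ℝ}
    (hK : ∀ N, MeasurableSet (K N)) (hu0 : ∀ N, 0 ≤ u N) (hu : Summable u) (hv : Summable v)
    (hin : ∀ᶠ N in atTop, ∀ y ∈ K N, tiltedProb y (B N) ≤ u N)
    (hout : ∀ᶠ N in atTop, (∫ y in (K N)ᶜ, mixingDensity β y ^ (N ^ 2)) /
      (∫ y, mixingDensity β y ^ (N ^ 2)) ≤ v N) :
    Summable fun N => curieWeissProb β (B N) := by
  refine .of_norm_bounded_eventually_nat (hu.add hv) ?_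
  filter_upwards [hin, hout, eventually_gt_atTop 0] with N hN₁ hN₂ hN
  have : NeZero N := ⟨hN.ne'⟩
  have hcard : Fintype.card (Fin N × Fin N) = N ^ 2 := by simp [sq]
  rw [Real.norm_of_nonneg (curieWeissProb_nonneg _ _)]
  refine (curieWeissProb_le_of_tiltedProb_le hβ (hK N) (hu0 N) hN₁).trans ?_
  rw [hcard]
  exact add_le_add_right hN₂ _

lemma exists_tiltedProb_le (k : ℕ) : ∃ C : ℝ, 0 ≤ C ∧ ∀ (N : ℕ) (y s : ℝ)
    (B : Finset (Fin N × Fin N → ℤˣ)), 0 < N → 0 < s →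
      (∀ x ∈ B, s ≤ |‖signMatrix x‖ - |Real.tanh y| * N|) →
        tiltedProb y B ≤ C * (N ^ (k + 1) / s ^ (2 * k)) := by
  refine ⟨4 ^ k * ((1 + (2 * k + 4 * k ^ 3)) ^ k * 4 ^ k), by positivity,
    fun N y s B hN hs hB => ?_⟩
  have : NeZero N := ⟨hN.ne'⟩
  have hmarkov := tiltedProb_mul_pow_le hs.le (fun x hx => (hB x hx).trans ?_) k (y := y) (B := B)
  · have htrace := traceMoment_two_mul_le_const_mul_pow (n := Fin N) k
    rw [Fintype.card_fin] at htrace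
    rw [← mul_div_assoc, le_div_iff₀ (by positivity), mul_assoc]
    exact hmarkov.trans (mul_le_mul_of_nonneg_left htrace (by positivity))
  · simpa using abs_norm_sub_abs_mul_card_le (signMatrix x) (Real.tanh y)

end GaussianMixtureSummability

section LowTemperature

open scoped Matrix.Norms.L2Operator

lemma le_abs_norm_sub_of_mem_farNormConfigs {N : ℕ} (hN : 0 < N) {y₀ y ε : ℝ}
    (hy : |(|y|) - y₀| ≤ ε / 2) {x : Fin N × Fin N → ℤˣ}
    (hx : x ∈ farNormConfigs (Fin N) (1 / N) (Real.tanh y₀) ε) :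
    ε / 2 * N ≤ |‖signMatrix x‖ - |Real.tanh y| * N| := by
  have hN' : (0 : ℝ) < N := Nat.cast_pos.2 hN
  have htanh : |(|Real.tanh y|) - Real.tanh y₀| ≤ ε / 2 := by
    rw [abs_tanh]
    exact (abs_tanh_sub_tanh_le _ _).trans hy
  have hscale : ‖signMatrix x‖ - |Real.tanh y| * N =
      (1 / N * ‖signMatrix x‖ - |Real.tanh y|) * N := by field_simp
  rw [hscale, abs_mul, abs_of_pos hN']
  gcongr
  linarith [mem_farNormConfigs.1 hx,
    abs_sub_le (1 / N * ‖signMatrix x‖) |Real.tanh y| (Real.tanh y₀)]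

lemma summable_curieWeissProb_farNormConfigs {β y₀ : ℝ} (hβ : 0 < β) (hy0 : 0 < y₀)
    (hy : Real.tanh y₀ = y₀ / β) {ε : ℝ} (hε : 0 < ε) :
    Summable fun N : ℕ =>
      curieWeissProb β (farNormConfigs (Fin N) (1 / N) (Real.tanh y₀) ε) := by
  obtain ⟨C, ρ, hρ0, hρ1, hout⟩ :=
    exists_setIntegral_mixingDensity_pow_div_le hβ hy0 hy (half_pos hε)
  obtain ⟨D, hD, hin⟩ := exists_tiltedProb_le 3
  have hgeom : Summable fun N : ℕ => C * ρ ^ (N ^ 2) :=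
    ((summable_geometric_of_lt_one hρ0 hρ1).comp_injective
      (Nat.pow_left_injective two_ne_zero)).mul_left C
  refine summable_curieWeissProb_of_tiltedProb_le hβ
    (fun _ => measurableSet_abs_abs_sub_le y₀ (ε / 2)) (fun N => by positivity)
    ((Real.summable_nat_pow_inv.2 one_lt_two).mul_left (D / (ε / 2) ^ 6)) hgeom ?_ ?_
  · filter_upwards [eventually_gt_atTop 0] with N hN y hyK
    have : (0 : ℝ) < N := Nat.cast_pos.2 hN
    refine (hin N y (ε / 2 * N) _ hN (by positivity) fun x hx =>
      le_abs_norm_sub_of_mem_farNormConfigs hN hyK hx).trans_eq ?_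
    field_simp
    ring
  · filter_upwards [eventually_gt_atTop 0] with N hN
    exact hout (N ^ 2) (by positivity)

end LowTemperature

section CriticalTemperature

open Asymptotics
open scoped Matrix.Norms.L2Operator

lemma superpolynomialDecay_exp_neg_mul_rpow {a b : ℝ} (ha : 0 < a) (hb : 0 < b) :
    SuperpolynomialDecay atTop (fun N : ℕ => (N : ℝ)) fun N => Real.exp (-a * (N : ℝ) ^ b) := by
  intro k
  refine ((tendsto_rpow_mul_exp_neg_mul_atTop_nhds_zero (k / b) a ha).comp
    ((tendsto_rpow_atTop hb).comp tendsto_natCast_atTop_atTop)).congr fun N => ?_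
  simp only [Function.comp_apply]
  rw [← Real.rpow_mul N.cast_nonneg, mul_div_cancel₀ _ hb.ne', Real.rpow_natCast]

-- For `|y| ≤ N ^ (γ - 1)` the rank-one part has norm at most `N ^ γ`; outside this window the
-- mixing density contributes `exp (-N ^ (4 γ - 2) / 24)`.
lemma summable_curieWeissProb_one_largeNormConfigs {γ : ℝ} (hγ : 1 / 2 < γ) (hγ1 : γ ≤ 1) :
    Summable fun N : ℕ => curieWeissProb 1 (largeNormConfigs (Fin N) (2 * (N : ℝ) ^ γ)) := by
  obtain ⟨C, hout⟩ := exists_setIntegral_mixingDensity_one_pow_div_le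
  obtain ⟨k, hk⟩ := exists_nat_ge (3 / (2 * γ - 1))
  rw [div_le_iff₀ (by linarith)] at hk
  obtain ⟨D, hD, hin⟩ := exists_tiltedProb_le k
  have hexp := summable_of_superpolynomialDecay (((superpolynomialDecay_exp_neg_mul_rpow
    (by norm_num : (0 : ℝ) < 1 / 24) (by linarith : 0 < 4 * γ - 2)).param_pow_mul 2).const_mul C)
  refine summable_curieWeissProb_of_tiltedProb_le one_pos
    (fun N => measurableSet_abs_le ((N : ℝ) ^ (γ - 1))) (fun N => by positivity)
    ((Real.summable_nat_pow_inv.2 one_lt_two).mul_left D) hexp ?_ ?_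
  all_goals
    filter_upwards [eventually_gt_atTop 0] with N hN
    have hN0 : (0 : ℝ) < N := Nat.cast_pos.2 hN
    have hN1 : (1 : ℝ) ≤ N := Nat.one_le_cast.2 hN
  · intro y hy
    have hrank_one : |Real.tanh y| * N ≤ (N : ℝ) ^ γ := by
      calc |Real.tanh y| * N ≤ (N : ℝ) ^ (γ - 1) * N := by
            gcongr
            exact (abs_tanh_le_abs y).trans hy
        _ = (N : ℝ) ^ γ := by rw [← Real.rpow_add_one hN0.ne', sub_add_cancel]
    have hpow : (N : ℝ) ^ (k + 3) ≤ ((N : ℝ) ^ γ) ^ (2 * k) := by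
      rw [← Real.rpow_natCast, ← Real.rpow_natCast ((N : ℝ) ^ γ), ← Real.rpow_mul hN0.le]
      refine Real.rpow_le_rpow_of_exponent_le hN1 ?_
      push_cast
      linarith
    refine (hin N y ((N : ℝ) ^ γ) _ hN (by positivity) fun x hx => ?_).trans ?_
    · exact le_abs.2 (.inl (by linarith [mem_largeNormConfigs.1 hx]))
    · gcongr
      rw [div_le_iff₀ (by positivity), le_inv_mul_iff₀ (by positivity)]
      exact (by ring : (N : ℝ) ^ 2 * N ^ (k + 1) = N ^ (k + 3)).trans_le hpow
  · refine (hout (N ^ 2) _ (by positivity) (by positivity)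
      (Real.rpow_le_one_of_one_le_of_nonpos hN1 (by linarith))).trans_eq ?_
    have hr4 : (N : ℝ) ^ 2 * ((N : ℝ) ^ (γ - 1)) ^ 4 = (N : ℝ) ^ (4 * γ - 2) := by
      rw [← Real.rpow_natCast, ← Real.rpow_natCast, ← Real.rpow_mul hN0.le, ← Real.rpow_add hN0]
      congr 1
      push_cast
      ring
    rw [Nat.cast_pow, hr4]
    simp only [Pi.mul_apply, Pi.pow_apply]
    ring_nf

lemma IsFullCurieWeissEnsemble.ae_tendsto_norm_rpow {Ω : Type*} [MeasurableSpace Ω]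
    {P : Measure Ω} [IsProbabilityMeasure P] {X : (N : ℕ) → Ω → Matrix (Fin N) (Fin N) ℝ}
    (hX : IsFullCurieWeissEnsemble P 1 X) :
    ∀ᵐ ω ∂P, ∀ γ : ℝ, 1 / 2 < γ →
      Tendsto (fun N : ℕ => euclideanOpNorm ((1 / (N : ℝ) ^ γ) • X N ω)) atTop (𝓝 0) := by
  have hbound (q : ℚ) (hq : (1 / 2 : ℝ) < q) (hq1 : (q : ℝ) ≤ 1) : ∀ᵐ ω ∂P, ∀ᶠ N : ℕ in atTop,
      X N ω ∉ {A | 2 * (N : ℝ) ^ (q : ℝ) ≤ ‖A‖} :=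
    hX.ae_eventually_notMem (fun N x hx => mem_largeNormConfigs.2 hx)
      (summable_curieWeissProb_one_largeNormConfigs hq hq1)
  filter_upwards [ae_all_iff.2 fun q => ae_all_iff.2 fun hq => ae_all_iff.2 (hbound q hq)]
    with ω hω γ hγ
  obtain ⟨q, hq, hqlt⟩ := exists_rat_btwn (lt_min hγ one_half_lt_one)
  obtain ⟨hqγ, hq1⟩ := lt_min_iff.1 hqlt
  have hlim : Tendsto (fun N : ℕ => 2 * (N : ℝ) ^ (-(γ - q))) atTop (𝓝 0) := by
    simpa using ((tendsto_rpow_neg_atTop (sub_pos.2 hqγ)).comp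
      tendsto_natCast_atTop_atTop).const_mul 2
  refine squeeze_zero' (.of_forall fun N => norm_nonneg _) ?_ hlim
  filter_upwards [hω q hq hq1.le, eventually_gt_atTop 0] with N hnorm hN
  have hN0 : (0 : ℝ) < N := Nat.cast_pos.2 hN
  rw [euclideanOpNorm_eq_norm, norm_smul, Real.norm_of_nonneg (by positivity), one_div_mul_eq_div,
    div_le_iff₀ (by positivity), mul_assoc, ← Real.rpow_add hN0, neg_sub, sub_add_cancel]
  exact (not_le.1 hnorm).le

end CriticalTemperature

lemma IsCurieWeissMagnetization.eq {β m m' : ℝ} (hβ : 0 < β) (h : IsCurieWeissMagnetization β m)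
    (h' : IsCurieWeissMagnetization β m') : m = m' := by
  have hratio {a : ℝ} (ha : IsCurieWeissMagnetization β a) :
      Real.tanh (β * a) / (β * a) = β⁻¹ := by
    rw [ha.2, div_mul_cancel_right₀ ha.1.ne']
  exact mul_left_cancel₀ hβ.ne' <| strictAntiOn_tanh_div.injOn (mul_pos hβ h.1) (mul_pos hβ h'.1)
    ((hratio h).trans (hratio h').symm)

end

theorem theorem7p8 {Ω : Type*} [MeasurableSpace Ω] (P : Measure Ω) [IsProbabilityMeasure P]
    (β : ℝ) (hβ : 0 ≤ β) (X : (N : ℕ) → Ω → Matrix (Fin N) (Fin N) ℝ)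
    (hX : IsFullCurieWeissEnsemble P β X) :
    (β < 1 → ∀ᵐ ω ∂P,
      Tendsto (fun N : ℕ => euclideanOpNorm ((1 / Real.sqrt (N : ℝ)) • X N ω)) atTop (𝓝 2)) ∧
    (β = 1 → ∀ᵐ ω ∂P, ∀ γ : ℝ, 1 / 2 < γ →
      Tendsto (fun N : ℕ => euclideanOpNorm ((1 / (N : ℝ) ^ γ) • X N ω)) atTop (𝓝 0)) ∧
    (1 < β → ∃ m : ℝ, IsCurieWeissMagnetization β m ∧
      (∀ m' : ℝ, IsCurieWeissMagnetization β m' → m' = m) ∧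
      ∀ᵐ ω ∂P,
        Tendsto (fun N : ℕ => euclideanOpNorm ((1 / (N : ℝ)) • X N ω)) atTop (𝓝 m)) := by
  refine ⟨fun hβ1 => ?_, fun hβ1 => ?_, fun hβ1 => ?_⟩
  · exact hX.ae_tendsto_norm (fun N => by positivity) fun ε hε =>
      summable_curieWeissProb_of_superpolynomialDecay hβ hβ1
        (superpolynomialDecay_dens_farNormConfigs hε)
  · subst hβ1
    exact hX.ae_tendsto_norm_rpow
  · have hβ0 : 0 < β := one_pos.trans hβ1
    obtain ⟨y, hy0, hy⟩ := exists_tanh_eq_div hβ1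
    have hm : IsCurieWeissMagnetization β (Real.tanh y) :=
      ⟨hy ▸ div_pos hy0 hβ0, by rw [hy, mul_div_cancel₀ _ hβ0.ne', hy]⟩
    exact ⟨Real.tanh y, hm, fun m' hm' => hm'.eq hβ0 hm,
      hX.ae_tendsto_norm (fun N => by positivity) fun ε hε =>
        summable_curieWeissProb_farNormConfigs hβ0 hy0 hy hε⟩
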